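/- Let $(S_j)_{j\ge 0}$ be simple random walk on $\mathbb{Z}^2$, and let $\mathbf{P}_x$ denote its law when $S_0=x$. For $B\subseteq\mathbb{Z}^2$ let $\tau_B=\inf\{j\ge 1: S_j\in B\}$. For a finite nonempty $A\subset\mathbb{Z}^2$, let $\mathbb{H}_A(y)=\lim_{|x|\to\infty}\mathbf{P}_x(S_{\tau_A}=y)$ be the harmonic measure of $A$ from infinity (this limit exists for every $y \in \mathbb{Z}^2$). For real $d > 0$, let $A_d$ be the set of all elements of $\mathbb{Z}^2$ within Euclidean distance $d$ of $A$, and let $\partial A_d$ be its exterior boundary, i.e. the set of sites outside $A_d$ that have a nearest neighbor in $A_d$. Let $\mathrm{diam}(A)$ be the Euclidean diameter of $A$. There exists a universal constant $c>0$ such that, if $A$ is a finite subset of $\mathbb{Z}^2$ with $n\ge 2$ elements and if $d\ge 2\,\mathrm{diam}(A)$, then, for any $x\in A$, $$\mathbf{P}_x(\tau_{\partial A_d}<\tau_A)\ \ge\ \frac{c\,\mathbb{H}_A(x)}{n\log d}.$$ In particular, $$\max_{x\in A}\mathbf{P}_x(\tau_{\partial A_d}<\tau_A)\ \ge\ \frac{c}{n^2\log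 d}.$$ -/

import Mathlib

open MeasureTheory ProbabilityTheory Filter Topology

/-- The point of the Euclidean plane given by a site of the square lattice.
(The metric that `ℤ × ℤ` carries in Mathlib is the sup metric, which is not used.) -/
noncomputable def toPlane (z : ℤ × ℤ) : EuclideanSpace ℝ (Fin 2) := !₂[(z.1 : ℝ), (z.2 : ℝ)]

/-- The Euclidean diameter of a finite set of lattice sites. -/
noncomputable def latticeDiam (A : Finset (ℤ × ℤ)) : ℝ :=
  Metric.diam (toPlane '' (A : Set (ℤ × ℤ)))

/-- The `d`-fattening of `A`: the lattice sites within Euclidean distance `d` of `A`. -/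
def fattening (A : Finset (ℤ × ℤ)) (d : ℝ) : Set (ℤ × ℤ) :=
  {z | ∃ a ∈ A, dist (toPlane z) (toPlane a) ≤ d}

/-- The exterior boundary of a set `B` of lattice sites: the sites outside of `B` which are at
Euclidean distance one from (that is, are nearest neighbors of) some site of `B`. -/
def exteriorBoundary (B : Set (ℤ × ℤ)) : Set (ℤ × ℤ) :=
  {y | y ∉ B ∧ ∃ z ∈ B, dist (toPlane y) (toPlane z) = 1}

/-- The four unit steps of simple random walk. -/
def unitSteps : Finset (ℤ × ℤ) := {(1, 0), (-1, 0), (0, 1), (0, -1)}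

theorem unitSteps_nonempty : unitSteps.Nonempty := ⟨(1, 0), by simp [unitSteps]⟩

/-- The uniform distribution on the four unit steps. -/
noncomputable def stepLaw : Measure (ℤ × ℤ) :=
  (PMF.uniformOfFinset unitSteps unitSteps_nonempty).toMeasure

instance instIsProbabilityMeasureStepLaw : IsProbabilityMeasure stepLaw :=
  PMF.toMeasure.isProbabilityMeasure _

/-- The law of an i.i.d. sequence of uniform unit steps. -/
noncomputable def stepsLaw : Measure (ℕ → ℤ × ℤ) := Measure.infinitePi fun _ => stepLaw

instance instIsProbabilityMeasureStepsLaw : IsProbabilityMeasure stepsLaw := by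
  unfold stepsLaw; infer_instance

/-- The position `S_j` of the walk from `x` at time `j`, as a function of the sequence `ω` of its
steps. Under `stepsLaw`, this is simple random walk on the square lattice with `S_0 = x`. -/
def walk (x : ℤ × ℤ) (j : ℕ) (ω : ℕ → ℤ × ℤ) : ℤ × ℤ := x + ∑ i ∈ Finset.range j, ω i

/-- `τ_B = inf {j ≥ 1 : S_j ∈ B}` for the walk from `x`, equal to `⊤` if there is no such `j`. -/
noncomputable def hitTime (x : ℤ × ℤ) (B : Set (ℤ × ℤ)) (ω : ℕ → ℤ × ℤ) : WithTop ℕ :=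
  hittingAfter (walk x) B 1 ω

/-- The hitting distribution `H_A(x, y) = P_x (S_{τ_A} = y)`. -/
noncomputable def hittingDist (A : Finset (ℤ × ℤ)) (x y : ℤ × ℤ) : ℝ :=
  stepsLaw.real {ω | ∃ j : ℕ, hitTime x (A : Set (ℤ × ℤ)) ω = (j : WithTop ℕ) ∧ walk x j ω = y}

/-- The harmonic measure (from infinity) `H_A(y) = lim_{|x| → ∞} H_A(x, y)`. Balls in the lattice
are finite, so `|x| → ∞` means that `x` leaves every finite set. -/
noncomputable def harmonicMeasure (A : Finset (ℤ × ℤ)) (y : ℤ × ℤ) : ℝ :=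
  limUnder cofinite fun x => hittingDist A x y

/-- The escape probability `P_x (τ_{∂ A_d} < τ_A)`. -/
noncomputable def escapeProb (A : Finset (ℤ × ℤ)) (d : ℝ) (x : ℤ × ℤ) : ℝ :=
  stepsLaw.real
    {ω | hitTime x (exteriorBoundary (fattening A d)) ω < hitTime x (A : Set (ℤ × ℤ)) ω}

/-! Let `h = exteriorHarmonic A`, the limit as `x → ∞` of the Green's function `G_A(y, x)` of the
walk killed on `A`. It vanishes on `A`, is harmonic off `A`, and grows at most logarithmically
(`exteriorHarmonic_le`). Splitting off the last step before the walk enters `A`, and using the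
symmetry of `G_A`, shows that `ℍ_A(x)` is the average of `h` over the neighbours of `x`
(`harmonicMeasure_eq`). On `∂A_d` one has `h ≤ 8 log d`, so the minimum principle on `A_d \ A`
bounds `h` by `8 log d` times the probability of reaching `∂A_d` before `A`. Averaging over the
neighbours of `x ∈ A` gives `ℍ_A(x) ≤ 8 log d · P_x(τ_{∂A_d} < τ_A)`, which is stronger than the
claim by a factor `n`. The bound on the maximum follows because the harmonic measures of the points
of `A` sum to at least `1`.

The work lies in the existence of `h` and its logarithmic bound. The walk is recurrent, so its
Green's function is first discounted by `r < 1` per step. For `y ∉ A` the resolvent identity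
expresses the killed Green's function through the potential kernel `a_r(x) = G_r(0) - G_r(x)` and a
quantity `missedGreen` that does not depend on `x`. Four facts let `r → 1`: `a_r` is at most
logarithmic up to a vanishing error (`potential_le`), `G_r(0) → ∞`, `(1 - r) G_r(0) → 0`, and `G_r`
is nearly constant under any fixed displacement far from the origin (`mem_flatDisplacements`). The
underlying kernel estimates come from the factorization of the planar walk into two walks on `ℤ`. -/

/-! ### Fourier estimates for simple random walk on `ℤ`. -/

/-- The transition probabilities of simple random walk on `ℤ`, in Fourier form. -/
noncomputable def lineKernel (n : ℕ) (u : ℤ) : ℝ :=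
  (∫ θ in (0 : ℝ)..Real.pi, Real.cos θ ^ n * Real.cos (u * θ)) / Real.pi

theorem lineKernel_zero (u : ℤ) : lineKernel 0 u = if u = 0 then 1 else 0 := by
  unfold lineKernel
  split_ifs with h
  · subst h; simp [Real.pi_ne_zero]
  · have hu : (u : ℝ) ≠ 0 := by exact_mod_cast h
    simp [intervalIntegral.integral_comp_mul_left (fun x => Real.cos x) hu]

theorem lineKernel_succ (n : ℕ) (u : ℤ) :
    lineKernel (n + 1) u = (lineKernel n (u + 1) + lineKernel n (u - 1)) / 2 := by
  unfold lineKernel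
  rw [← add_div, ← intervalIntegral.integral_add
    (Continuous.intervalIntegrable (by fun_prop) _ _)
    (Continuous.intervalIntegrable (by fun_prop) _ _), div_right_comm]
  congr 1
  rw [eq_div_iff two_ne_zero, ← intervalIntegral.integral_mul_const]
  refine intervalIntegral.integral_congr fun θ _ => ?_
  push_cast
  rw [show ((u : ℝ) + 1) * θ = u * θ + θ by ring, show ((u : ℝ) - 1) * θ = u * θ - θ by ring,
    Real.cos_add, Real.cos_sub]
  ring

theorem abs_lineKernel_sub_le {f : ℝ → ℝ} (n : ℕ) (u v : ℤ) (hf : Continuous f)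
    (h : ∀ θ ∈ Set.Icc 0 Real.pi,
      |Real.cos θ ^ n * Real.cos (u * θ) - Real.cos θ ^ n * Real.cos (v * θ)| ≤ f θ) :
    |lineKernel n u - lineKernel n v| ≤ (∫ θ in (0 : ℝ)..Real.pi, f θ) / Real.pi := by
  unfold lineKernel
  rw [← sub_div, abs_div, abs_of_pos Real.pi_pos, ← intervalIntegral.integral_sub
    (Continuous.intervalIntegrable (by fun_prop) _ _)
    (Continuous.intervalIntegrable (by fun_prop) _ _)]
  refine div_le_div_of_nonneg_right ?_ Real.pi_pos.le
  rw [← Real.norm_eq_abs]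
  refine intervalIntegral.norm_integral_le_of_norm_le Real.pi_pos.le ?_
    (hf.intervalIntegrable _ _)
  exact Filter.Eventually.of_forall fun θ hθ => h θ ⟨hθ.1.le, hθ.2⟩

theorem abs_sin_natCast_mul_le (j : ℕ) (θ : ℝ) : |Real.sin (j * θ)| ≤ j * |Real.sin θ| := by
  induction j with
  | zero => simp
  | succ j ih =>
    push_cast
    rw [add_mul, one_mul, Real.sin_add, add_mul, one_mul]
    refine (abs_add_le _ _).trans (add_le_add ?_ ?_)
    · rw [abs_mul]
      exact (mul_le_of_le_one_right (abs_nonneg _) (Real.abs_cos_le_one _)).trans ih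
    · rw [abs_mul]
      exact mul_le_of_le_one_left (abs_nonneg _) (Real.abs_cos_le_one _)

theorem sin_intCast_mul_sq_le (j : ℤ) (θ : ℝ) :
    Real.sin (j * θ) ^ 2 ≤ (j : ℝ) ^ 2 * Real.sin θ ^ 2 := by
  have h : |Real.sin (j * θ)| ≤ |(j : ℝ)| * |Real.sin θ| := by
    have := abs_sin_natCast_mul_le j.natAbs θ
    rw [Nat.cast_natAbs, Int.cast_abs] at this
    rcases abs_choice (j : ℝ) with h | h <;> rw [h] at this ⊢
    · exact this
    · rwa [neg_mul, Real.sin_neg, abs_neg] at this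
  rw [← mul_pow, ← sq_abs, ← sq_abs (_ * _), abs_mul]
  exact pow_le_pow_left₀ (abs_nonneg _) h 2

/-- The return probability of simple random walk on `ℤ` at time `2 k`. -/
noncomputable def lineReturn (k : ℕ) : ℝ := lineKernel (2 * k) 0

theorem lineReturn_eq (k : ℕ) :
    lineReturn k = (∫ θ in (0 : ℝ)..Real.pi, Real.cos θ ^ (2 * k)) / Real.pi := by
  simp [lineReturn, lineKernel]

theorem lineReturn_zero : lineReturn 0 = 1 := by simp [lineReturn, lineKernel_zero]

theorem lineReturn_succ (k : ℕ) :
    lineReturn (k + 1) = (2 * k + 1) / (2 * k + 2) * lineReturn k := by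
  rw [lineReturn_eq, lineReturn_eq, show 2 * (k + 1) = 2 * k + 2 by ring, integral_cos_pow]
  simp
  ring

theorem lineReturn_pos (k : ℕ) : 0 < lineReturn k := by
  induction k with
  | zero => simp [lineReturn_zero]
  | succ k ih => rw [lineReturn_succ]; positivity

/-- Wallis-type bounds, by induction on the ratio of consecutive terms. This one makes planar return
probabilities `O(1/k)`; the matching lower bound below makes their sum diverge. -/
theorem lineReturn_sq_le (k : ℕ) : lineReturn k ^ 2 ≤ 1 / (2 * k + 1) := by
  induction k with
  | zero => simp [lineReturn_zero]
  | succ k ih =>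
    rw [lineReturn_succ, mul_pow]
    refine (mul_le_mul_of_nonneg_left ih (by positivity)).trans ?_
    push_cast
    rw [div_pow, div_mul_div_comm, div_le_div_iff₀ (by positivity) (by positivity)]
    have : (0 : ℝ) ≤ k := k.cast_nonneg
    nlinarith [mul_nonneg this this, mul_nonneg (mul_nonneg this this) this]

theorem le_lineReturn_sq (k : ℕ) : 1 / (4 * k + 1) ≤ lineReturn k ^ 2 := by
  induction k with
  | zero => simp [lineReturn_zero]
  | succ k ih =>
    rw [lineReturn_succ, mul_pow]
    refine le_trans ?_ (mul_le_mul_of_nonneg_left ih (by positivity))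
    push_cast
    rw [div_pow, div_mul_div_comm, div_le_div_iff₀ (by positivity) (by positivity)]
    have : (0 : ℝ) ≤ k := k.cast_nonneg
    nlinarith [mul_nonneg this this, mul_nonneg (mul_nonneg this this) this]

theorem abs_lineKernel_even_le (k : ℕ) (u : ℤ) : |lineKernel (2 * k) u| ≤ lineReturn k := by
  rw [lineReturn_eq]
  unfold lineKernel
  rw [abs_div, abs_of_pos Real.pi_pos]
  refine div_le_div_of_nonneg_right ?_ Real.pi_pos.le
  rw [← Real.norm_eq_abs]
  refine intervalIntegral.norm_integral_le_of_norm_le Real.pi_pos.le ?_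
    (Continuous.intervalIntegrable (by fun_prop) _ _)
  refine Filter.Eventually.of_forall fun θ _ => ?_
  have h0 : 0 ≤ Real.cos θ ^ (2 * k) := by rw [pow_mul]; positivity
  rw [Real.norm_eq_abs, abs_mul, abs_of_nonneg h0]
  exact mul_le_of_le_one_right h0 (Real.abs_cos_le_one _)

/-- Here `1 - cos 2jθ = 2 sin² jθ ≤ 2 j² sin² θ`, and integrating `cos^{2k} θ sin² θ` gives the
difference of two consecutive return probabilities, a fraction `1/(2k+2)` of the first. -/
theorem lineReturn_sub_lineKernel_le (k : ℕ) (j : ℤ) :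
    lineReturn k - lineKernel (2 * k) (2 * j) ≤ (j : ℝ) ^ 2 * lineReturn k / (k + 1) := by
  have h1 := abs_lineKernel_sub_le
    (f := fun θ => 2 * (j : ℝ) ^ 2 * (Real.cos θ ^ (2 * k) - Real.cos θ ^ (2 * (k + 1))))
    (2 * k) 0 (2 * j) (by fun_prop) fun θ _ => by
      have h0 : 0 ≤ Real.cos θ ^ (2 * k) := by rw [pow_mul]; positivity
      rw [← mul_sub, abs_mul, abs_of_nonneg h0]
      have h2 : Real.cos (((2 * j : ℤ) : ℝ) * θ) = 1 - 2 * Real.sin (j * θ) ^ 2 := by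
        push_cast
        rw [mul_assoc, Real.cos_two_mul, Real.sin_sq]
        ring
      rw [h2]
      simp only [Int.cast_zero, zero_mul, Real.cos_zero, sub_sub_cancel]
      rw [abs_of_nonneg (by positivity)]
      have h3 := sin_intCast_mul_sq_le j θ
      calc Real.cos θ ^ (2 * k) * (2 * Real.sin (j * θ) ^ 2)
          ≤ Real.cos θ ^ (2 * k) * (2 * ((j : ℝ) ^ 2 * Real.sin θ ^ 2)) := by gcongr
        _ = _ := by rw [Real.sin_sq]; ring
  refine (le_abs_self _).trans (h1.trans (le_of_eq ?_))
  rw [intervalIntegral.integral_const_mul, intervalIntegral.integral_sub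
    (Continuous.intervalIntegrable (by fun_prop) _ _)
    (Continuous.intervalIntegrable (by fun_prop) _ _), mul_div_assoc, sub_div,
    ← lineReturn_eq, ← lineReturn_eq, lineReturn_succ]
  field_simp
  ring

/-- The difference of cosines is at most `2 sin θ` on `[0, π]`, and `cos^{2k} θ sin θ` has an
explicit antiderivative. The decay `1/k` is a factor `k^{-1/2}` better than that of the kernel
itself. -/
theorem abs_lineKernel_even_sub_le (k : ℕ) (u : ℤ) :
    |lineKernel (2 * k) u - lineKernel (2 * k) (u + 2)| ≤ 2 / (2 * k + 1) := by
  have h1 := abs_lineKernel_sub_le (f := fun θ => 2 * (Real.cos θ ^ (2 * k) * Real.sin θ))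
    (2 * k) u (u + 2) (by fun_prop) fun θ hθ => by
      have h0 : 0 ≤ Real.cos θ ^ (2 * k) := by rw [pow_mul]; positivity
      have hs : 0 ≤ Real.sin θ := Real.sin_nonneg_of_mem_Icc hθ
      rw [← mul_sub, abs_mul, abs_of_nonneg h0, ← mul_left_comm]
      refine mul_le_mul_of_nonneg_left ?_ h0
      have h2 : Real.cos (u * θ) - Real.cos (((u + 2 : ℤ) : ℝ) * θ)
          = 2 * (Real.sin ((u + 1) * θ) * Real.sin θ) := by
        push_cast
        rw [show (u : ℝ) * θ = (u + 1) * θ - θ by ring,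
          show ((u : ℝ) + 2) * θ = (u + 1) * θ + θ by ring, Real.cos_add, Real.cos_sub]
        ring
      rw [h2, abs_mul, abs_mul, abs_of_nonneg hs, abs_two]
      gcongr
      exact mul_le_of_le_one_left hs (Real.abs_sin_le_one _)
  refine h1.trans ?_
  have hI : ∫ θ in (0 : ℝ)..Real.pi, Real.cos θ ^ (2 * k) * Real.sin θ = 2 / (2 * k + 1) := by
    have h3 : ∀ θ ∈ Set.uIcc 0 Real.pi,
        HasDerivAt (fun θ => -(Real.cos θ ^ (2 * k + 1)) / (2 * k + 1))
          (Real.cos θ ^ (2 * k) * Real.sin θ) θ := fun θ _ => by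
      have := (((Real.hasDerivAt_cos θ).fun_pow (2 * k + 1)).fun_neg).div_const (2 * (k : ℝ) + 1)
      refine this.congr_deriv ?_
      push_cast
      simp
      field_simp
    rw [intervalIntegral.integral_eq_sub_of_hasDerivAt h3
      (Continuous.intervalIntegrable (by fun_prop) _ _)]
    simp [pow_succ, pow_mul]
    ring
  rw [intervalIntegral.integral_const_mul, hI, div_le_iff₀ Real.pi_pos,
    mul_comm (2 / (2 * (k : ℝ) + 1))]
  exact mul_le_mul_of_nonneg_right (by linarith [Real.pi_gt_three]) (by positivity)

theorem abs_lineKernel_le (n : ℕ) (u : ℤ) : |lineKernel n u| ≤ lineReturn (n / 2) := by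
  rcases Nat.even_or_odd' n with ⟨k, rfl | rfl⟩
  · rw [Nat.mul_div_cancel_left _ two_pos]; exact abs_lineKernel_even_le k u
  · rw [lineKernel_succ, show (2 * k + 1) / 2 = k by omega, abs_div, abs_two]
    have := abs_add_le (lineKernel (2 * k) (u + 1)) (lineKernel (2 * k) (u - 1))
    linarith [abs_lineKernel_even_le k (u + 1), abs_lineKernel_even_le k (u - 1)]

theorem abs_lineKernel_sub_add_two_le (n : ℕ) (u : ℤ) :
    |lineKernel n u - lineKernel n (u + 2)| ≤ 4 / (n + 1) := by
  rcases Nat.even_or_odd' n with ⟨k, rfl | rfl⟩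
  · refine (abs_lineKernel_even_sub_le k u).trans ?_
    push_cast
    gcongr
    norm_num
  · have h1 := abs_lineKernel_even_sub_le k (u + 1)
    have h2 := abs_lineKernel_even_sub_le k (u - 1)
    rw [show u - 1 + 2 = u + 2 - 1 by ring] at h2
    rw [show u + 1 + 2 = u + 2 + 1 by ring] at h1
    rw [lineKernel_succ, lineKernel_succ]
    have h3 : |(lineKernel (2 * k) (u + 1) + lineKernel (2 * k) (u - 1)) / 2 -
        (lineKernel (2 * k) (u + 2 + 1) + lineKernel (2 * k) (u + 2 - 1)) / 2|
        ≤ 2 / (2 * k + 1) := by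
      rw [abs_le] at *
      constructor <;> linarith [h1.1, h1.2, h2.1, h2.2]
    refine h3.trans ?_
    push_cast
    rw [div_le_div_iff₀ (by positivity) (by positivity)]
    have : (0 : ℝ) ≤ k := k.cast_nonneg
    linarith

/-! ### The averaging operator of the square lattice. -/

/-- The average of a function over the four nearest neighbors of a site. -/
noncomputable def latticeAvg (f : ℤ × ℤ → ℝ) (x : ℤ × ℤ) : ℝ :=
  (∑ e ∈ unitSteps, f (x + e)) / 4

theorem sum_unitSteps {M : Type*} [AddCommMonoid M] (f : ℤ × ℤ → M) :
    ∑ e ∈ unitSteps, f e = f (1, 0) + (f (-1, 0) + (f (0, 1) + f (0, -1))) := by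
  simp [unitSteps, Finset.sum_insert]

theorem card_unitSteps : unitSteps.card = 4 := rfl

theorem latticeAvg_const (c : ℝ) (x : ℤ × ℤ) : latticeAvg (fun _ => c) x = c := by
  simp [latticeAvg, card_unitSteps]

theorem latticeAvg_mono {f g : ℤ × ℤ → ℝ} {x : ℤ × ℤ}
    (h : ∀ e ∈ unitSteps, f (x + e) ≤ g (x + e)) : latticeAvg f x ≤ latticeAvg g x :=
  div_le_div_of_nonneg_right (Finset.sum_le_sum h) (by norm_num)

theorem latticeAvg_nonneg {f : ℤ × ℤ → ℝ} {x : ℤ × ℤ}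
    (h : ∀ e ∈ unitSteps, 0 ≤ f (x + e)) : 0 ≤ latticeAvg f x :=
  div_nonneg (Finset.sum_nonneg h) (by norm_num)

theorem latticeAvg_le {f : ℤ × ℤ → ℝ} {x : ℤ × ℤ} {c : ℝ}
    (h : ∀ e ∈ unitSteps, f (x + e) ≤ c) : latticeAvg f x ≤ c :=
  (latticeAvg_mono h).trans_eq (latticeAvg_const c x)

theorem latticeAvg_add (f g : ℤ × ℤ → ℝ) (x : ℤ × ℤ) :
    latticeAvg (fun y => f y + g y) x = latticeAvg f x + latticeAvg g x := by
  simp [latticeAvg, Finset.sum_add_distrib, add_div]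

theorem latticeAvg_sub (f g : ℤ × ℤ → ℝ) (x : ℤ × ℤ) :
    latticeAvg (fun y => f y - g y) x = latticeAvg f x - latticeAvg g x := by
  simp [latticeAvg, Finset.sum_sub_distrib, sub_div]

theorem latticeAvg_mul_left (c : ℝ) (f : ℤ × ℤ → ℝ) (x : ℤ × ℤ) :
    latticeAvg (fun y => c * f y) x = c * latticeAvg f x := by
  simp [latticeAvg, ← Finset.mul_sum, mul_div_assoc]

theorem latticeAvg_sum {ι : Type*} (s : Finset ι) (f : ι → ℤ × ℤ → ℝ) (x : ℤ × ℤ) :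
    latticeAvg (fun y => ∑ i ∈ s, f i y) x = ∑ i ∈ s, latticeAvg (f i) x := by
  simp only [latticeAvg]
  rw [Finset.sum_comm, Finset.sum_div]

theorem latticeAvg_tsum {f : ℕ → ℤ × ℤ → ℝ} (hf : ∀ y, Summable fun n => f n y) (x : ℤ × ℤ) :
    latticeAvg (fun y => ∑' n, f n y) x = ∑' n, latticeAvg (f n) x := by
  simp only [latticeAvg]
  rw [tsum_div_const, Summable.tsum_finsetSum fun e _ => hf _]

theorem summable_latticeAvg {f : ℕ → ℤ × ℤ → ℝ} (hf : ∀ y, Summable fun n => f n y)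
    (x : ℤ × ℤ) : Summable fun n => latticeAvg (f n) x :=
  (summable_sum fun _ _ => hf _).div_const _

theorem latticeAvg_comp_sub (f : ℤ × ℤ → ℝ) (x z : ℤ × ℤ) :
    latticeAvg (fun y => f (y - z)) x = latticeAvg f (x - z) := by
  simp only [latticeAvg, sub_add_eq_add_sub]

theorem abs_latticeAvg_le {f : ℤ × ℤ → ℝ} {x : ℤ × ℤ} {c : ℝ}
    (h : ∀ e ∈ unitSteps, |f (x + e)| ≤ c) : |latticeAvg f x| ≤ c :=
  abs_le.2 ⟨(latticeAvg_const (-c) x).symm.trans_le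
    (latticeAvg_mono fun e he => (abs_le.1 (h e he)).1),
    latticeAvg_le fun e he => (abs_le.1 (h e he)).2⟩

/-! ### Transition probabilities of simple random walk on `ℤ²`. -/

/-- The transition probabilities `p_n(x)` of simple random walk on `ℤ²`. -/
noncomputable def srwKernel : ℕ → ℤ × ℤ → ℝ
  | 0, x => if x = 0 then 1 else 0
  | n + 1, x => latticeAvg (srwKernel n) x

theorem srwKernel_succ (n : ℕ) (x : ℤ × ℤ) :
    srwKernel (n + 1) x = latticeAvg (srwKernel n) x := rfl

theorem srwKernel_nonneg (n : ℕ) (x : ℤ × ℤ) : 0 ≤ srwKernel n x := by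
  induction n generalizing x with
  | zero => unfold srwKernel; split_ifs <;> norm_num
  | succ n ih => exact latticeAvg_nonneg fun e _ => ih _

theorem srwKernel_le_one (n : ℕ) (x : ℤ × ℤ) : srwKernel n x ≤ 1 := by
  induction n generalizing x with
  | zero => unfold srwKernel; split_ifs <;> norm_num
  | succ n ih => exact latticeAvg_le fun e _ => ih _

/-- Each unit step changes `x.1 + x.2` and `x.1 - x.2` by independent fair signs, so the two rotated
coordinates are independent walks on `ℤ`. -/
theorem srwKernel_eq_lineKernel (n : ℕ) (x : ℤ × ℤ) :
    srwKernel n x = lineKernel n (x.1 + x.2) * lineKernel n (x.1 - x.2) := by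
  induction n generalizing x with
  | zero =>
    obtain ⟨a, b⟩ := x
    simp only [srwKernel, lineKernel_zero, Prod.mk_eq_zero]
    by_cases h1 : a + b = 0 <;> by_cases h2 : a - b = 0 <;> simp [h1, h2] <;> omega
  | succ n ih =>
    obtain ⟨a, b⟩ := x
    simp only [srwKernel_succ, latticeAvg, sum_unitSteps, ih, lineKernel_succ, Prod.mk_add_mk]
    rw [show a + 1 + (b + 0) = a + b + 1 by ring, show a + 1 - (b + 0) = a - b + 1 by ring,
      show a + -1 + (b + 0) = a + b - 1 by ring, show a + -1 - (b + 0) = a - b - 1 by ring,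
      show a + 0 + (b + 1) = a + b + 1 by ring, show a + 0 - (b + 1) = a - b - 1 by ring,
      show a + 0 + (b + -1) = a + b - 1 by ring, show a + 0 - (b + -1) = a - b + 1 by ring]
    ring

theorem srwKernel_odd_eq_zero {x : ℤ × ℤ} (hx : Even (x.1 + x.2)) (k : ℕ) :
    srwKernel (2 * k + 1) x = 0 := by
  have key : ∀ (n : ℕ) (x : ℤ × ℤ), ¬ Even ((n : ℤ) + x.1 + x.2) → srwKernel n x = 0 := by
    intro n
    induction n with
    | zero =>
      intro x h
      have : x ≠ 0 := by rintro rfl; simp at h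
      simp [srwKernel, this]
    | succ n ih =>
      intro x h
      simp only [srwKernel_succ, latticeAvg, sum_unitSteps]
      rw [ih, ih, ih, ih]
      · simp
      all_goals
        simp only [Prod.fst_add, Prod.snd_add]
        push_cast at h
        rw [Int.even_iff] at *
        omega
  refine key _ _ ?_
  push_cast
  rw [Int.even_iff] at *
  omega

theorem srwKernel_zero_right (k : ℕ) : srwKernel (2 * k) 0 = lineReturn k ^ 2 := by
  simp [srwKernel_eq_lineKernel, lineReturn, sq]

theorem srwKernel_le_srwKernel_zero (k : ℕ) (x : ℤ × ℤ) :
    srwKernel (2 * k) x ≤ srwKernel (2 * k) 0 := by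
  rw [srwKernel_zero_right, srwKernel_eq_lineKernel]
  refine (le_abs_self _).trans ?_
  rw [abs_mul, sq]
  exact mul_le_mul (abs_lineKernel_even_le _ _) (abs_lineKernel_even_le _ _) (abs_nonneg _)
    (lineReturn_pos k).le

theorem srwKernel_zero_le (k : ℕ) : srwKernel (2 * k) 0 ≤ 1 / (k + 1) := by
  rw [srwKernel_zero_right]
  refine (lineReturn_sq_le k).trans ?_
  have : (0 : ℝ) ≤ k := k.cast_nonneg
  gcongr
  linarith

/-- Even parity makes both rotated coordinates even, so the one-dimensional bound applies to each
factor. The decay `k⁻²` makes the series for the potential kernel converge. -/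
theorem srwKernel_zero_sub_le {x : ℤ × ℤ} (hx : Even (x.1 + x.2)) (k : ℕ) :
    srwKernel (2 * k) 0 - srwKernel (2 * k) x
      ≤ ((x.1 : ℝ) ^ 2 + (x.2 : ℝ) ^ 2) / (k + 1) ^ 2 := by
  obtain ⟨i, hi⟩ := hx.two_dvd
  obtain ⟨j, hj⟩ : (2 : ℤ) ∣ x.1 - x.2 := ⟨i - x.2, by linarith⟩
  have hm : (x.1 : ℝ) ^ 2 + (x.2 : ℝ) ^ 2 = 2 * ((i : ℝ) ^ 2 + (j : ℝ) ^ 2) := by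
    have h1 : x.1 = i + j := by linarith
    have h2 : x.2 = i - j := by linarith
    rw [h1, h2]; push_cast; ring
  rw [hm, srwKernel_zero_right, srwKernel_eq_lineKernel, hi, hj]
  have h1 := lineReturn_sub_lineKernel_le k i
  have h2 := lineReturn_sub_lineKernel_le k j
  have h3 := (le_abs_self _).trans (abs_lineKernel_even_le k (2 * i))
  have h4 := (le_abs_self _).trans (abs_lineKernel_even_le k (2 * j))
  have hw := lineReturn_pos k
  have h5 := (lineReturn_sq_le k)
  have hk : (0 : ℝ) ≤ k := k.cast_nonneg
  calc lineReturn k ^ 2 - lineKernel (2 * k) (2 * i) * lineKernel (2 * k) (2 * j)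
      = lineReturn k * (lineReturn k - lineKernel (2 * k) (2 * i))
        + lineKernel (2 * k) (2 * i) * (lineReturn k - lineKernel (2 * k) (2 * j)) := by ring
    _ ≤ lineReturn k * ((i : ℝ) ^ 2 * lineReturn k / (k + 1))
        + lineReturn k * ((j : ℝ) ^ 2 * lineReturn k / (k + 1)) := by
      refine add_le_add (mul_le_mul_of_nonneg_left h1 hw.le) ?_
      refine (mul_le_mul_of_nonneg_right h3 (by linarith)).trans ?_
      exact mul_le_mul_of_nonneg_left h2 hw.le
    _ = ((i : ℝ) ^ 2 + (j : ℝ) ^ 2) / (k + 1) * lineReturn k ^ 2 := by ring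
    _ ≤ ((i : ℝ) ^ 2 + (j : ℝ) ^ 2) / (k + 1) * (1 / (2 * k + 1)) := by gcongr
    _ ≤ ((i : ℝ) ^ 2 + (j : ℝ) ^ 2) / (k + 1) * (2 / (k + 1)) := by
      gcongr ?_ * ?_
      rw [div_le_div_iff₀ (by positivity) (by positivity)]
      linarith
    _ = _ := by field_simp

/-- A uniform bound on the differences of `srwKernel n` along diagonal steps. -/
noncomputable def gradientBound (n : ℕ) : ℝ := 4 / (n + 1) * lineReturn (n / 2)

/-- One factor decays like `1/n` and the other like `n^{-1/2}`, for a total of order `n^{-3/2}`. -/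
theorem summable_gradientBound : Summable gradientBound := by
  have h0 : Summable fun n : ℕ => 8 * (1 / ((n + 1 : ℕ) : ℝ) ^ (3 / 2 : ℝ)) :=
    ((summable_nat_add_iff 1).2
      (Real.summable_one_div_nat_rpow.2 (by norm_num : (1 : ℝ) < 3 / 2))).mul_left 8
  refine Summable.of_nonneg_of_le (fun n => ?_) (fun n => ?_) h0
  · have := lineReturn_pos (n / 2)
    unfold gradientBound; positivity
  · have hn : (0 : ℝ) < n + 1 := by positivity
    have h1 : lineReturn (n / 2) ≤ 2 / Real.sqrt (n + 1) := by
      refine abs_le_of_sq_le_sq' ?_ (by positivity) |>.2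
      rw [div_pow, Real.sq_sqrt hn.le]
      refine (lineReturn_sq_le _).trans ?_
      rw [div_le_div_iff₀ (by positivity) hn]
      have : ((n : ℕ) : ℝ) ≤ 2 * ((n / 2 : ℕ) : ℝ) + 1 := by
        exact_mod_cast (by omega : n ≤ 2 * (n / 2) + 1)
      have : (0 : ℝ) ≤ ((n / 2 : ℕ) : ℝ) := Nat.cast_nonneg _
      linarith
    have h2 : (n + 1 : ℝ) ^ (3 / 2 : ℝ) = (n + 1) * Real.sqrt (n + 1) := by
      rw [Real.sqrt_eq_rpow, show (3 / 2 : ℝ) = 1 + 1 / 2 by norm_num, Real.rpow_add hn,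
        Real.rpow_one]
    push_cast
    rw [h2]
    calc gradientBound n ≤ 4 / (n + 1) * (2 / Real.sqrt (n + 1)) := by
          unfold gradientBound; gcongr
      _ = _ := by field_simp; norm_num

theorem abs_srwKernel_sub_diag_le (n : ℕ) (x : ℤ × ℤ) :
    |srwKernel n x - srwKernel n (x + (1, 1))| ≤ gradientBound n := by
  rw [srwKernel_eq_lineKernel, srwKernel_eq_lineKernel, Prod.fst_add, Prod.snd_add,
    show x.1 + 1 + (x.2 + 1) = x.1 + x.2 + 2 by ring,
    show x.1 + 1 - (x.2 + 1) = x.1 - x.2 by ring, ← sub_mul, abs_mul]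
  exact mul_le_mul (abs_lineKernel_sub_add_two_le _ _) (abs_lineKernel_le _ _) (abs_nonneg _)
    (by positivity)

theorem abs_srwKernel_sub_antidiag_le (n : ℕ) (x : ℤ × ℤ) :
    |srwKernel n x - srwKernel n (x + (1, -1))| ≤ gradientBound n := by
  rw [srwKernel_eq_lineKernel, srwKernel_eq_lineKernel, Prod.fst_add, Prod.snd_add,
    show x.1 + 1 + (x.2 + -1) = x.1 + x.2 by ring,
    show x.1 + 1 - (x.2 + -1) = x.1 - x.2 + 2 by ring, ← mul_sub, abs_mul, mul_comm]
  exact mul_le_mul (abs_lineKernel_sub_add_two_le _ _) (abs_lineKernel_le _ _) (abs_nonneg _)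
    (by positivity)

/-! ### The discounted Green's function and potential kernel. -/

/-- The Green's function of simple random walk on `ℤ²`, discounted by a factor `r` per step. -/
noncomputable def green (r : ℝ) (x : ℤ × ℤ) : ℝ := ∑' n, r ^ n * srwKernel n x

/-- The discounted potential kernel. -/
noncomputable def potential (r : ℝ) (x : ℤ × ℤ) : ℝ := green r 0 - green r x

section Discount

variable {r : ℝ}

theorem summable_green (h0 : 0 ≤ r) (h1 : r < 1) (x : ℤ × ℤ) :
    Summable fun n => r ^ n * srwKernel n x :=
  Summable.of_nonneg_of_le (fun n => mul_nonneg (pow_nonneg h0 n) (srwKernel_nonneg n x))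
    (fun n => mul_le_of_le_one_right (pow_nonneg h0 n) (srwKernel_le_one n x))
    (summable_geometric_of_lt_one h0 h1)

theorem green_nonneg (h0 : 0 ≤ r) (x : ℤ × ℤ) : 0 ≤ green r x :=
  tsum_nonneg fun n => mul_nonneg (pow_nonneg h0 n) (srwKernel_nonneg n x)

theorem green_eq (h0 : 0 ≤ r) (h1 : r < 1) (x : ℤ × ℤ) :
    green r x = (if x = 0 then 1 else 0) + r * latticeAvg (green r) x := by
  unfold green
  rw [(summable_green h0 h1 x).tsum_eq_zero_add, latticeAvg_tsum (summable_green h0 h1),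
    ← tsum_mul_left]
  simp only [pow_zero, one_mul, srwKernel_succ, latticeAvg_mul_left, pow_succ]
  congr 1
  exact tsum_congr fun n => by ring

theorem green_even {x : ℤ × ℤ} (hx : Even (x.1 + x.2)) :
    green r x = ∑' k, r ^ (2 * k) * srwKernel (2 * k) x := by
  unfold green
  refine ((Function.Injective.tsum_eq (g := fun k : ℕ => 2 * k)
    (fun a b h => by simpa using h) fun n hn => ?_)).symm
  rcases Nat.even_or_odd' n with ⟨k, rfl | rfl⟩
  · exact ⟨k, rfl⟩
  · simp [srwKernel_odd_eq_zero hx] at hn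

theorem summable_green_even (h0 : 0 ≤ r) (h1 : r < 1) (x : ℤ × ℤ) :
    Summable fun k => r ^ (2 * k) * srwKernel (2 * k) x :=
  (summable_green h0 h1 x).comp_injective (i := fun k : ℕ => 2 * k)
    fun a b h => by simpa using h

theorem even_add_unitStep {x e : ℤ × ℤ} (hx : ¬ Even (x.1 + x.2)) (he : e ∈ unitSteps) :
    Even ((x + e).1 + (x + e).2) := by
  simp only [unitSteps, Finset.mem_insert, Finset.mem_singleton] at he
  rw [Int.even_iff] at *
  rcases he with rfl | rfl | rfl | rfl <;> simp <;> omega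

theorem ne_zero_of_odd {x : ℤ × ℤ} (hx : ¬ Even (x.1 + x.2)) : x ≠ 0 := by
  rintro rfl; simp at hx

theorem green_le_green_zero (h0 : 0 ≤ r) (h1 : r < 1) (x : ℤ × ℤ) : green r x ≤ green r 0 := by
  have key : ∀ x : ℤ × ℤ, Even (x.1 + x.2) → green r x ≤ green r 0 := fun x hx => by
    rw [green_even hx, green_even (x := 0) (by simp)]
    refine Summable.tsum_le_tsum (fun k => ?_) (summable_green_even h0 h1 x)
      (summable_green_even h0 h1 0)
    exact mul_le_mul_of_nonneg_left (srwKernel_le_srwKernel_zero k x) (pow_nonneg h0 _)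
  by_cases hx : Even (x.1 + x.2)
  · exact key x hx
  · rw [green_eq h0 h1, if_neg (ne_zero_of_odd hx), zero_add]
    exact (mul_le_mul_of_nonneg_left (latticeAvg_le fun e he => key _ (even_add_unitStep hx he))
      h0).trans (mul_le_of_le_one_left (green_nonneg h0 0) h1.le)

theorem potential_nonneg (h0 : 0 ≤ r) (h1 : r < 1) (x : ℤ × ℤ) : 0 ≤ potential r x :=
  sub_nonneg.2 (green_le_green_zero h0 h1 x)

/-- The sum is split at `m`, later taken to be `|x|²`. The first `m` terms are dominated by a
harmonic sum, and the rest telescope through `m/(j+1)² ≤ m/j - m/(j+1)` to at most `1`. -/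
theorem sum_range_le_two_add_log {D : ℕ → ℝ} {m : ℕ} (hm : m ≠ 0) (hD0 : ∀ k, 0 ≤ D k)
    (hD1 : ∀ k, D k ≤ 1 / (k + 1)) (hD2 : ∀ k, D k ≤ m / (k + 1) ^ 2) (N : ℕ) :
    ∑ k ∈ Finset.range N, D k ≤ 2 + Real.log m := by
  have hm0 : (0 : ℝ) < m := by exact_mod_cast Nat.pos_of_ne_zero hm
  have htail : ∀ N : ℕ, ∑ j ∈ Finset.range N, D (m + j) ≤ 1 - m / (m + N) := by
    intro N
    induction N with
    | zero => simp [hm0.ne']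
    | succ N ih =>
      rw [Finset.sum_range_succ]
      have h1 := hD2 (m + N)
      have h2 : (m : ℝ) / ((m + N : ℕ) + 1) ^ 2 ≤ m / (m + N) - m / (m + (N + 1 : ℕ)) := by
        have hN : (0 : ℝ) < m + N := by positivity
        push_cast
        rw [div_sub_div _ _ hN.ne' (by positivity),
          div_le_div_iff₀ (by positivity) (by positivity)]
        have h3 : (m : ℝ) * (m + (N + 1)) - (m + N) * m = m := by ring
        rw [h3]
        refine mul_le_mul_of_nonneg_left ?_ hm0.le
        nlinarith
      linarith
  have hhead : ∑ k ∈ Finset.range m, D k ≤ 1 + Real.log m := by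
    refine le_trans ?_ (harmonic_le_one_add_log m)
    rw [harmonic]
    push_cast
    refine Finset.sum_le_sum fun k _ => ?_
    simpa using hD1 k
  calc ∑ k ∈ Finset.range N, D k ≤ ∑ k ∈ Finset.range (m + N), D k :=
        Finset.sum_le_sum_of_subset_of_nonneg (Finset.range_mono (by omega)) fun k _ _ => hD0 k
    _ = ∑ k ∈ Finset.range m, D k + ∑ j ∈ Finset.range N, D (m + j) :=
        Finset.sum_range_add ..
    _ ≤ 2 + Real.log m := by
        have := htail N
        have : (0 : ℝ) ≤ m / (m + N) := by positivity
        linarith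

/-- The logarithmic upper bound on the potential kernel. -/
noncomputable def logBound (x : ℤ × ℤ) : ℝ :=
  2 + Real.log (2 * ((x.1 : ℝ) ^ 2 + (x.2 : ℝ) ^ 2) + 3)

theorem potential_even_le (h0 : 0 ≤ r) (h1 : r < 1) {x : ℤ × ℤ} (hx : Even (x.1 + x.2)) :
    potential r x ≤ 2 + Real.log ((x.1 : ℝ) ^ 2 + (x.2 : ℝ) ^ 2 + 1) := by
  by_cases hx0 : x = 0
  · simp [potential, hx0]
  set m : ℕ := x.1.natAbs ^ 2 + x.2.natAbs ^ 2 with hmdef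
  have hm : (m : ℝ) = (x.1 : ℝ) ^ 2 + (x.2 : ℝ) ^ 2 := by
    rw [hmdef]; push_cast; simp [Nat.cast_natAbs, sq_abs]
  have hm0 : m ≠ 0 := by
    intro h
    apply hx0
    rw [hmdef] at h
    ext <;> simp at h ⊢ <;> tauto
  rw [potential, green_even hx, green_even (x := 0) (by simp),
    ← (summable_green_even h0 h1 0).tsum_sub (summable_green_even h0 h1 x)]
  have hterm : ∀ k, 0 ≤ srwKernel (2 * k) 0 - srwKernel (2 * k) x := fun k =>
    sub_nonneg.2 (srwKernel_le_srwKernel_zero k x)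
  have hr : ∀ k, r ^ (2 * k) ≤ 1 := fun k => pow_le_one₀ h0 h1.le
  have hle : ∀ k, r ^ (2 * k) * srwKernel (2 * k) 0 - r ^ (2 * k) * srwKernel (2 * k) x
      ≤ srwKernel (2 * k) 0 - srwKernel (2 * k) x := fun k => by
    rw [← mul_sub]; exact mul_le_of_le_one_left (hterm k) (hr k)
  refine (Real.tsum_le_of_sum_range_le (c := 2 + Real.log m) (fun k => ?_) fun N => ?_).trans ?_
  · rw [← mul_sub]; exact mul_nonneg (pow_nonneg h0 _) (hterm k)
  · refine (Finset.sum_le_sum fun k _ => hle k).trans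
      (sum_range_le_two_add_log hm0 hterm (fun k => ?_) (fun k => ?_) N)
    · linarith [srwKernel_zero_le k, srwKernel_nonneg (2 * k) x]
    · rw [hm]; exact srwKernel_zero_sub_le hx k
  · rw [hm]
    have : 0 < (x.1 : ℝ) ^ 2 + (x.2 : ℝ) ^ 2 := by
      rw [← hm]; exact_mod_cast Nat.pos_of_ne_zero hm0
    have := Real.log_le_log this (le_add_of_nonneg_right zero_le_one)
    linarith

/-- At an odd site the Green's equation reduces to the four neighbours, which are even. The discount
in that equation produces the error term `(1 - r) * green r 0`. -/
theorem potential_le (h0 : 0 ≤ r) (h1 : r < 1) (x : ℤ × ℤ) :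
    potential r x ≤ logBound x + (1 - r) * green r 0 := by
  have hg := mul_nonneg (sub_nonneg.2 h1.le) (green_nonneg h0 0)
  have hm : 0 ≤ (x.1 : ℝ) ^ 2 + (x.2 : ℝ) ^ 2 := by positivity
  have hL : 0 ≤ logBound x := by
    have := Real.log_nonneg (x := 2 * ((x.1 : ℝ) ^ 2 + (x.2 : ℝ) ^ 2) + 3) (by linarith)
    unfold logBound; linarith
  by_cases hx : Even (x.1 + x.2)
  · refine (potential_even_le h0 h1 hx).trans (le_add_of_le_of_nonneg ?_ hg)
    exact add_le_add_right (Real.log_le_log (by linarith) (by linarith)) 2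
  · have h2 : latticeAvg (potential r) x ≤ logBound x := latticeAvg_le fun e he => by
      refine (potential_even_le h0 h1 (even_add_unitStep hx he)).trans ?_
      refine add_le_add_right (Real.log_le_log (by positivity) ?_) 2
      simp only [unitSteps, Finset.mem_insert, Finset.mem_singleton] at he
      rcases he with rfl | rfl | rfl | rfl <;> simp <;>
        nlinarith [sq_nonneg ((x.1 : ℝ) - 1), sq_nonneg ((x.1 : ℝ) + 1),
          sq_nonneg ((x.2 : ℝ) - 1), sq_nonneg ((x.2 : ℝ) + 1)]
    have h3 : latticeAvg (potential r) x = green r 0 - latticeAvg (green r) x := by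
      unfold potential; rw [latticeAvg_sub, latticeAvg_const]
    have h4 := green_eq h0 h1 x
    rw [if_neg (ne_zero_of_odd hx), zero_add] at h4
    have h5 : potential r x = r * latticeAvg (potential r) x + (1 - r) * green r 0 := by
      rw [h3, potential, h4]; ring
    rw [h5]
    have : r * latticeAvg (potential r) x ≤ logBound x :=
      (mul_le_mul_of_nonneg_left h2 h0).trans (mul_le_of_le_one_left hL h1.le)
    linarith

end Discount

theorem eventually_discount : ∀ᶠ r : ℝ in 𝓝[<] 1, 0 ≤ r ∧ r < 1 := by
  filter_upwards [self_mem_nhdsWithin, mem_nhdsWithin_of_mem_nhds (Ici_mem_nhds one_pos)]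
    with r h1 h0 using ⟨h0, h1⟩

/-- An Abelian statement: it holds because the return probabilities tend to `0`. -/
theorem tendsto_one_sub_mul_green : Tendsto (fun r => (1 - r) * green r 0) (𝓝[<] 1) (𝓝 0) := by
  rw [Metric.tendsto_nhds]
  intro ε hε
  obtain ⟨N, hN⟩ := exists_nat_gt (2 / ε)
  have hlim : Tendsto (fun r : ℝ => (1 - r) * (N : ℝ)) (𝓝[<] 1) (𝓝 0) := by
    refine Tendsto.mono_left ?_ nhdsWithin_le_nhds
    have : ContinuousAt (fun r : ℝ => (1 - r) * (N : ℝ)) 1 := by fun_prop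
    simpa using this.tendsto
  filter_upwards [eventually_discount, hlim.eventually (gt_mem_nhds (half_pos hε))]
    with r ⟨h0, h1⟩ hr
  have hr1 : 0 < 1 - r := by linarith
  rw [Real.dist_eq, sub_zero, abs_of_nonneg (mul_nonneg hr1.le (green_nonneg h0 0))]
  have hgeo := summable_geometric_of_lt_one h0 h1
  have hs := summable_green_even h0 h1 0
  have hN0 : (0 : ℝ) < N := (by positivity : (0 : ℝ) < 2 / ε).trans hN
  -- The first `N` even times contribute at most `1` each. After them the return probability is
  -- below `ε / 2`, since `N > 2 / ε`, and what remains is compared with a geometric series.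
  have hq : green r 0 ≤ N + ε / 2 * (1 - r)⁻¹ := by
    rw [green_even (by simp), ← hs.sum_add_tsum_nat_add N]
    refine add_le_add ?_ ?_
    · refine (Finset.sum_le_card_nsmul _ _ 1 fun k _ => ?_).trans_eq (by simp)
      exact mul_le_one₀ (pow_le_one₀ h0 h1.le) (srwKernel_nonneg _ _) (srwKernel_le_one _ _)
    · rw [← tsum_geometric_of_lt_one h0 h1, ← tsum_mul_left]
      refine Summable.tsum_le_tsum (fun k => ?_) ((summable_nat_add_iff N).2 hs)
        (hgeo.mul_left _)
      rw [mul_comm]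
      refine mul_le_mul ?_ (pow_le_pow_of_le_one h0 h1.le (by omega)) (pow_nonneg h0 _)
        (by positivity)
      refine (srwKernel_zero_le _).trans ?_
      rw [div_le_iff₀ (by positivity)]
      rw [div_lt_iff₀ hε] at hN
      push_cast
      have : (0 : ℝ) ≤ k := k.cast_nonneg
      nlinarith [mul_nonneg this hε.le]
  calc (1 - r) * green r 0 ≤ (1 - r) * (N + ε / 2 * (1 - r)⁻¹) :=
        mul_le_mul_of_nonneg_left hq hr1.le
    _ = (1 - r) * N + ε / 2 := by field_simp
    _ < ε := by linarith

/-- Recurrence: the return probabilities at even times are at least `1/(4k+1)`, so partial sums of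
the series exceed any bound as `r → 1`. -/
theorem tendsto_green_zero : Tendsto (fun r => green r 0) (𝓝[<] 1) atTop := by
  rw [tendsto_atTop]
  intro B
  have hdiv : Tendsto (fun N : ℕ => ∑ k ∈ Finset.range N, srwKernel (2 * k) 0) atTop atTop := by
    have h1 := (Real.tendsto_sum_range_one_div_nat_succ_atTop).atTop_mul_const
      (show (0 : ℝ) < 1 / 4 by norm_num)
    refine tendsto_atTop_mono (fun N => ?_) h1
    rw [Finset.sum_mul]
    refine Finset.sum_le_sum fun k _ => ?_
    rw [srwKernel_zero_right]
    refine le_trans ?_ (le_lineReturn_sq k)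
    rw [div_mul_div_comm, div_le_div_iff₀ (by positivity) (by positivity)]
    linarith
  obtain ⟨N, hN⟩ := (hdiv.eventually (eventually_gt_atTop B)).exists
  have hcont : Tendsto (fun r : ℝ => ∑ k ∈ Finset.range N, r ^ (2 * k) * srwKernel (2 * k) 0)
      (𝓝[<] 1) (𝓝 (∑ k ∈ Finset.range N, srwKernel (2 * k) 0)) := by
    refine Tendsto.mono_left ?_ nhdsWithin_le_nhds
    have : Continuous fun r : ℝ =>
      ∑ k ∈ Finset.range N, r ^ (2 * k) * srwKernel (2 * k) 0 := by fun_prop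
    simpa using this.tendsto 1
  filter_upwards [eventually_discount, hcont.eventually (lt_mem_nhds hN)] with r ⟨h0, h1⟩ hr
  refine hr.le.trans ?_
  rw [green_even (by simp)]
  exact (summable_green_even h0 h1 0).sum_le_tsum _ fun k _ =>
    mul_nonneg (pow_nonneg h0 _) (srwKernel_nonneg _ _)

/-! ### Flatness of the Green's function at infinity. -/

/-- The displacements along which the Green's function varies little far from the origin,
uniformly in the discount. -/
def flatDisplacements : AddSubgroup (ℤ × ℤ) where
  carrier := {z | ∀ ε > 0, ∀ᶠ x in cofinite, ∀ᶠ r in 𝓝[<] 1, |green r x - green r (x + z)| ≤ ε}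
  zero_mem' := fun ε hε => by simp [hε.le]
  add_mem' := fun {a b} ha hb ε hε => by
    have hb' := (add_left_injective a).tendsto_cofinite.eventually (hb (ε / 2) (half_pos hε))
    filter_upwards [ha (ε / 2) (half_pos hε), hb'] with x h1 h2
    filter_upwards [h1, h2] with r h1 h2
    rw [← add_assoc]
    refine (abs_sub_le _ (green r (x + a)) _).trans (by linarith)
  neg_mem' := fun {a} ha ε hε => by
    have ha' := (add_left_injective (-a)).tendsto_cofinite.eventually (ha ε hε)
    filter_upwards [ha'] with x h
    filter_upwards [h] with r h
    rwa [neg_add_cancel_right, abs_sub_comm] at h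

/-- For fixed `n` the kernel vanishes far away, so dominated convergence makes the undiscounted sum
of absolute differences small. That sum bounds the difference of Green's functions for every `r`. -/
theorem mem_flatDisplacements_of_summable {z : ℤ × ℤ} {b : ℕ → ℝ} (hb : Summable b)
    (h : ∀ n x, |srwKernel n x - srwKernel n (x + z)| ≤ b n) : z ∈ flatDisplacements := by
  intro ε hε
  have hfin : ∀ n : ℕ, Tendsto (fun x => srwKernel n x) cofinite (𝓝 0) := by
    intro n
    induction n with
    | zero =>
      refine tendsto_const_nhds.congr' ?_
      filter_upwards [(Set.finite_singleton (0 : ℤ × ℤ)).compl_mem_cofinite] with x hx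
      simp only [Set.mem_compl_iff, Set.mem_singleton_iff] at hx
      simp [srwKernel, hx]
    | succ n ih =>
      have h1 : Tendsto (fun x : ℤ × ℤ => (∑ e ∈ unitSteps, srwKernel n (x + e)) / 4) cofinite
          (𝓝 ((∑ e ∈ unitSteps, (0 : ℝ)) / 4)) :=
        (tendsto_finsetSum _ fun e _ =>
          ih.comp (add_left_injective e).tendsto_cofinite).div_const _
      simpa [srwKernel_succ, latticeAvg] using h1
  have hterm : ∀ n, Tendsto (fun x => |srwKernel n x - srwKernel n (x + z)|) cofinite (𝓝 0) := by
    intro n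
    have := ((hfin n).sub ((hfin n).comp (add_left_injective z).tendsto_cofinite)).abs
    simpa using this
  have hlim : Tendsto (fun x => ∑' n, |srwKernel n x - srwKernel n (x + z)|) cofinite
      (𝓝 (∑' _ : ℕ, (0 : ℝ))) :=
    tendsto_tsum_of_dominated_convergence hb hterm
      (Eventually.of_forall fun x n => by simpa using h n x)
  rw [tsum_zero] at hlim
  filter_upwards [hlim.eventually (gt_mem_nhds hε)] with x hx
  filter_upwards [eventually_discount] with r ⟨h0, h1⟩
  have hs : Summable fun n => |srwKernel n x - srwKernel n (x + z)| :=
    Summable.of_nonneg_of_le (fun n => abs_nonneg _) (fun n => h n x) hb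
  refine le_trans ?_ hx.le
  unfold green
  rw [← (summable_green h0 h1 x).tsum_sub (summable_green h0 h1 (x + z)), ← Real.norm_eq_abs]
  refine tsum_of_norm_bounded hs.hasSum fun n => ?_
  rw [← mul_sub, Real.norm_eq_abs, abs_mul, abs_of_nonneg (pow_nonneg h0 n)]
  exact mul_le_of_le_one_left (abs_nonneg _) (pow_le_one₀ h0 h1.le)

/-- Away from the origin, `green r x` is `r` times the average over the sites `x + e'`, each of
which differs from `x + e` by `e' - e`. This passes from displacements of even parity to unit steps,
at the price of an error `(1 - r) * green r (x + e)`. -/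
theorem mem_flatDisplacements_of_unitSteps {e : ℤ × ℤ}
    (h : ∀ e' ∈ unitSteps, e' - e ∈ flatDisplacements) : e ∈ flatDisplacements := by
  intro ε hε
  have h' : ∀ᶠ x in cofinite, ∀ e' ∈ unitSteps, ∀ᶠ r in 𝓝[<] 1,
      |green r (x + e) - green r (x + e + (e' - e))| ≤ ε / 2 :=
    (Finset.eventually_all unitSteps).2 fun e' he' =>
      (add_left_injective e).tendsto_cofinite.eventually (h e' he' (ε / 2) (half_pos hε))
  filter_upwards [h', (Set.finite_singleton (0 : ℤ × ℤ)).compl_mem_cofinite] with x hx hx0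
  filter_upwards [eventually_discount, (Finset.eventually_all unitSteps).2 hx,
    tendsto_one_sub_mul_green.eventually (gt_mem_nhds (half_pos hε))] with r ⟨h0, h1⟩ hr hg
  have hgx := green_eq h0 h1 x
  rw [if_neg (by simpa using hx0), zero_add] at hgx
  have h2 : |latticeAvg (fun y => green r y - green r (x + e)) x| ≤ ε / 2 :=
    abs_latticeAvg_le fun e' he' => by
      have := hr e' he'
      rwa [show x + e + (e' - e) = x + e' by abel, abs_sub_comm] at this
  have h3 : green r x - green r (x + e) =
      r * latticeAvg (fun y => green r y - green r (x + e)) x - (1 - r) * green r (x + e) := by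
    rw [latticeAvg_sub, latticeAvg_const, hgx]; ring
  have h4 : |(1 - r) * green r (x + e)| ≤ ε / 2 := by
    rw [abs_of_nonneg (mul_nonneg (by linarith) (green_nonneg h0 _))]
    exact (mul_le_mul_of_nonneg_left (green_le_green_zero h0 h1 _) (by linarith)).trans hg.le
  rw [h3]
  refine (abs_sub _ _).trans ?_
  rw [abs_mul, abs_of_nonneg h0]
  have := mul_le_of_le_one_left (abs_nonneg _) h1.le |>.trans h2
  linarith

theorem mem_flatDisplacements (z : ℤ × ℤ) : z ∈ flatDisplacements := by
  have h1 : ((1, 1) : ℤ × ℤ) ∈ flatDisplacements :=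
    mem_flatDisplacements_of_summable summable_gradientBound abs_srwKernel_sub_diag_le
  have h2 : ((1, -1) : ℤ × ℤ) ∈ flatDisplacements :=
    mem_flatDisplacements_of_summable summable_gradientBound abs_srwKernel_sub_antidiag_le
  have h3 := zero_mem flatDisplacements
  have h4 := neg_mem h1
  have h5 := neg_mem h2
  have h6 := add_mem h1 h2
  have h7 := neg_mem h6
  have h8 := sub_mem h1 h2
  have h9 := neg_mem h8
  have hx : ((1, 0) : ℤ × ℤ) ∈ flatDisplacements :=
    mem_flatDisplacements_of_unitSteps fun e he => by
      simp only [unitSteps, Finset.mem_insert, Finset.mem_singleton] at he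
      rcases he with rfl | rfl | rfl | rfl <;> assumption
  have hy : ((0, 1) : ℤ × ℤ) ∈ flatDisplacements :=
    mem_flatDisplacements_of_unitSteps fun e he => by
      simp only [unitSteps, Finset.mem_insert, Finset.mem_singleton] at he
      rcases he with rfl | rfl | rfl | rfl <;> assumption
  have := add_mem (zsmul_mem hx z.1) (zsmul_mem hy z.2)
  simpa using this

/-! ### The walk killed on `A`. -/

/-- The `n`-step transition probabilities from `y` of simple random walk killed on `A`. -/
noncomputable def killedKernel (A : Finset (ℤ × ℤ)) (y : ℤ × ℤ) : ℕ → ℤ × ℤ → ℝ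
  | 0, x => if x = y ∧ y ∉ A then 1 else 0
  | n + 1, x => if x ∈ A then 0 else latticeAvg (killedKernel A y n) x

/-- The probability that the walk from `y` enters `A` at time `n + 1` and at the site `z ∈ A`. -/
noncomputable def hitProb (A : Finset (ℤ × ℤ)) (n : ℕ) (y z : ℤ × ℤ) : ℝ :=
  latticeAvg (killedKernel A y n) z

/-- The Green's function of the walk killed on `A`. -/
noncomputable def killedGreen (A : Finset (ℤ × ℤ)) (y x : ℤ × ℤ) : ℝ :=
  ∑' n, killedKernel A y n x

/-- The Green's function of the walk killed on `A`, discounted by a factor `r` per step. -/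
noncomputable def discountedKilledGreen (A : Finset (ℤ × ℤ)) (r : ℝ) (y x : ℤ × ℤ) : ℝ :=
  ∑' n, r ^ n * killedKernel A y n x

/-- The discounted probability that the walk from `y` enters `A` at the site `z ∈ A`. -/
noncomputable def discountedHit (A : Finset (ℤ × ℤ)) (r : ℝ) (y z : ℤ × ℤ) : ℝ :=
  r * latticeAvg (discountedKilledGreen A r y) z

/-- The Green's function at the origin weighted by the discounted probability of not hitting `A`. -/
noncomputable def missedGreen (A : Finset (ℤ × ℤ)) (r : ℝ) (y : ℤ × ℤ) : ℝ :=
  (1 - ∑ z ∈ A, discountedHit A r y z) * green r 0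

section Killed

variable {A : Finset (ℤ × ℤ)} {r : ℝ} {x y z : ℤ × ℤ}

theorem killedKernel_succ (n : ℕ) :
    killedKernel A y (n + 1) x = if x ∈ A then 0 else latticeAvg (killedKernel A y n) x := rfl

theorem killedKernel_nonneg (A : Finset (ℤ × ℤ)) (y : ℤ × ℤ) (n : ℕ) (x : ℤ × ℤ) :
    0 ≤ killedKernel A y n x := by
  induction n generalizing x with
  | zero => unfold killedKernel; split_ifs <;> norm_num
  | succ n ih =>
    unfold killedKernel
    split_ifs
    · exact le_rfl
    · exact latticeAvg_nonneg fun e _ => ih _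

theorem killedKernel_le_one (A : Finset (ℤ × ℤ)) (y : ℤ × ℤ) (n : ℕ) (x : ℤ × ℤ) :
    killedKernel A y n x ≤ 1 := by
  induction n generalizing x with
  | zero => unfold killedKernel; split_ifs <;> norm_num
  | succ n ih =>
    unfold killedKernel
    split_ifs
    · exact zero_le_one
    · exact latticeAvg_le fun e _ => ih _

theorem killedKernel_right_mem (hx : x ∈ A) (n : ℕ) : killedKernel A y n x = 0 := by
  cases n with
  | zero =>
    have : ¬ (x = y ∧ y ∉ A) := by rintro ⟨rfl, h⟩; exact h hx
    simp only [killedKernel, if_neg this]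
  | succ n => simp [killedKernel, hx]

theorem killedKernel_left_mem (hy : y ∈ A) (n : ℕ) (x : ℤ × ℤ) : killedKernel A y n x = 0 := by
  induction n generalizing x with
  | zero => simp [killedKernel, hy]
  | succ n ih => simp [killedKernel, latticeAvg, ih]

/-- The definition recurses on the end point `x`; this is the recursion on the starting point `y`.
Comparing the two gives the symmetry of the kernel. -/
theorem killedKernel_succ_left (n : ℕ) (x y : ℤ × ℤ) :
    killedKernel A y (n + 1) x =
      if y ∈ A then 0 else latticeAvg (fun y' => killedKernel A y' n x) y := by
  by_cases hy : y ∈ A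
  · simp [hy, killedKernel_left_mem]
  rw [if_neg hy]
  induction n generalizing x with
  | zero =>
    rw [killedKernel_succ]
    split_ifs with hx
    · simp [latticeAvg, killedKernel_right_mem hx]
    · have h1 : ∀ e : ℤ × ℤ, (x = y + -e ∧ y + -e ∉ A) ↔ x + e = y := fun e => by
        constructor
        · rintro ⟨h, _⟩; rw [h]; abel
        · intro h
          have : x = y + -e := by rw [← h]; abel
          exact ⟨this, this ▸ hx⟩
      have h2 : ∀ e : ℤ × ℤ, killedKernel A (y + -e) 0 x = killedKernel A y 0 (x + e) :=
        fun e => by simp only [killedKernel, h1, hy, not_false_eq_true, and_true]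
      have h3 := h2 (1, 0)
      have h4 := h2 (-1, 0)
      have h5 := h2 (0, 1)
      have h6 := h2 (0, -1)
      simp only [Prod.neg_mk, neg_neg, neg_zero] at h3 h4 h5 h6
      simp only [latticeAvg, sum_unitSteps, h3, h4, h5, h6]
      ring
  | succ n ih =>
    rw [killedKernel_succ]
    split_ifs with hx
    · simp [latticeAvg, killedKernel_right_mem hx]
    · simp only [killedKernel_succ (n := n), if_neg hx]
      simp only [latticeAvg, ih]
      rw [← Finset.sum_div, ← Finset.sum_div, Finset.sum_comm]

theorem killedKernel_symm (n : ℕ) (x y : ℤ × ℤ) :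
    killedKernel A y n x = killedKernel A x n y := by
  induction n generalizing x y with
  | zero =>
    simp only [killedKernel]
    by_cases h : x = y
    · subst h; rfl
    · simp [h, Ne.symm h]
  | succ n ih =>
    rw [killedKernel_succ_left, killedKernel_succ]
    simp only [fun y' => ih x y']

theorem hitProb_nonneg (A : Finset (ℤ × ℤ)) (n : ℕ) (y z : ℤ × ℤ) : 0 ≤ hitProb A n y z :=
  latticeAvg_nonneg fun _ _ => killedKernel_nonneg _ _ _ _

theorem hitProb_left_mem (hy : y ∈ A) (n : ℕ) (z : ℤ × ℤ) : hitProb A n y z = 0 := by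
  simp [hitProb, latticeAvg, killedKernel_left_mem hy]

theorem hitProb_zero (hy : y ∉ A) (z : ℤ × ℤ) :
    hitProb A 0 y z = latticeAvg (fun y' => if y' = z then 1 else 0) y := by
  have h1 : ∀ e : ℤ × ℤ, killedKernel A y 0 (z + -e) = if y + e = z then 1 else 0 := fun e => by
    have : z + -e = y ↔ y + e = z := by
      constructor
      · rintro rfl; abel
      · rintro rfl; abel
    simp [killedKernel, hy, this]
  have h3 := h1 (1, 0)
  have h4 := h1 (-1, 0)
  have h5 := h1 (0, 1)
  have h6 := h1 (0, -1)
  simp only [Prod.neg_mk, neg_neg, neg_zero] at h3 h4 h5 h6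
  simp only [hitProb, latticeAvg, sum_unitSteps, h3, h4, h5, h6]
  ring

theorem hitProb_succ (hy : y ∉ A) (n : ℕ) (z : ℤ × ℤ) :
    hitProb A (n + 1) y z = latticeAvg (fun y' => hitProb A n y' z) y := by
  simp only [hitProb, latticeAvg, killedKernel_succ_left, if_neg hy]
  rw [← Finset.sum_div, ← Finset.sum_div, Finset.sum_comm]

/-- The entries into `A` at different times or sites are disjoint. Here this follows by induction on
the first step. -/
theorem sum_hitProb_le_one (A : Finset (ℤ × ℤ)) (N : ℕ) (y : ℤ × ℤ) :
    ∑ n ∈ Finset.range N, ∑ z ∈ A, hitProb A n y z ≤ 1 := by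
  induction N generalizing y with
  | zero => simp
  | succ N ih =>
    by_cases hy : y ∈ A
    · simp [hitProb_left_mem hy]
    rw [Finset.sum_range_succ']
    simp only [hitProb_succ hy, hitProb_zero hy, ← latticeAvg_sum]
    rw [← latticeAvg_add]
    refine latticeAvg_le fun e _ => ?_
    by_cases he : y + e ∈ A
    · simp [hitProb_left_mem he, he]
    · simpa [he] using ih (y + e)

theorem summable_discountedKilledGreen (h0 : 0 ≤ r) (h1 : r < 1) (y x : ℤ × ℤ) :
    Summable fun n => r ^ n * killedKernel A y n x :=
  Summable.of_nonneg_of_le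
    (fun n => mul_nonneg (pow_nonneg h0 n) (killedKernel_nonneg A y n x))
    (fun n => mul_le_of_le_one_right (pow_nonneg h0 n) (killedKernel_le_one A y n x))
    (summable_geometric_of_lt_one h0 h1)

theorem discountedKilledGreen_nonneg (h0 : 0 ≤ r) (y x : ℤ × ℤ) :
    0 ≤ discountedKilledGreen A r y x :=
  tsum_nonneg fun n => mul_nonneg (pow_nonneg h0 n) (killedKernel_nonneg A y n x)

theorem discountedKilledGreen_le (h0 : 0 ≤ r) (h1 : r < 1) (y x : ℤ × ℤ) :
    discountedKilledGreen A r y x ≤ (1 - r)⁻¹ := by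
  rw [← tsum_geometric_of_lt_one h0 h1]
  exact Summable.tsum_le_tsum
    (fun n => mul_le_of_le_one_right (pow_nonneg h0 n) (killedKernel_le_one A y n x))
    (summable_discountedKilledGreen h0 h1 y x) (summable_geometric_of_lt_one h0 h1)

theorem discountedKilledGreen_right_mem (hx : x ∈ A) : discountedKilledGreen A r y x = 0 := by
  simp [discountedKilledGreen, killedKernel_right_mem hx]

theorem discountedKilledGreen_eq (h0 : 0 ≤ r) (h1 : r < 1) (hy : y ∉ A) (hx : x ∉ A) :
    discountedKilledGreen A r y x =
      (if x = y then 1 else 0) + r * latticeAvg (discountedKilledGreen A r y) x := by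
  unfold discountedKilledGreen
  rw [(summable_discountedKilledGreen h0 h1 y x).tsum_eq_zero_add,
    latticeAvg_tsum (summable_discountedKilledGreen h0 h1 y), ← tsum_mul_left]
  congr 1
  · simp [killedKernel, hy]
  · refine tsum_congr fun n => ?_
    rw [latticeAvg_mul_left, killedKernel_succ, if_neg hx, pow_succ]
    ring

theorem discountedHit_nonneg (h0 : 0 ≤ r) (y z : ℤ × ℤ) : 0 ≤ discountedHit A r y z :=
  mul_nonneg h0 (latticeAvg_nonneg fun _ _ => discountedKilledGreen_nonneg h0 _ _)

theorem hasSum_discountedHit (h0 : 0 ≤ r) (h1 : r < 1) (y z : ℤ × ℤ) :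
    HasSum (fun n => r ^ (n + 1) * hitProb A n y z) (discountedHit A r y z) := by
  have hs := summable_discountedKilledGreen (A := A) h0 h1 y
  unfold discountedHit discountedKilledGreen
  rw [latticeAvg_tsum hs]
  have h : (fun n => r ^ (n + 1) * hitProb A n y z) =
      fun n => r * latticeAvg (fun x => r ^ n * killedKernel A y n x) z := funext fun n => by
    rw [latticeAvg_mul_left, hitProb, pow_succ]
    ring
  rw [h]
  exact (summable_latticeAvg hs z).hasSum.mul_left r

theorem sum_discountedHit_le_one (h0 : 0 ≤ r) (h1 : r < 1) (y : ℤ × ℤ) :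
    ∑ z ∈ A, discountedHit A r y z ≤ 1 := by
  have h := hasSum_sum fun z (_ : z ∈ A) => hasSum_discountedHit (A := A) h0 h1 y z
  refine le_of_tendsto' h.tendsto_sum_nat fun N => le_trans ?_ (sum_hitProb_le_one A N y)
  exact Finset.sum_le_sum fun n _ => Finset.sum_le_sum fun z _ =>
    mul_le_of_le_one_left (hitProb_nonneg A n y z) (pow_le_one₀ h0 h1.le)

/-- Averaging does not increase the supremum, so `w ↦ r * latticeAvg w` contracts by `r < 1`. This
gives uniqueness among bounded solutions. -/
theorem eq_zero_of_eq_mul_latticeAvg (h0 : 0 ≤ r) (h1 : r < 1) {w : ℤ × ℤ → ℝ} {C : ℝ}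
    (hC : ∀ x, |w x| ≤ C) (hw : ∀ x, w x = r * latticeAvg w x) (x : ℤ × ℤ) : w x = 0 := by
  have h : ∀ (n : ℕ) x, |w x| ≤ r ^ n * C := by
    intro n
    induction n with
    | zero => simpa using hC
    | succ n ih =>
      intro x
      rw [hw, abs_mul, abs_of_nonneg h0, pow_succ', mul_assoc]
      exact mul_le_mul_of_nonneg_left (abs_latticeAvg_le fun e _ => ih _) h0
  have hlim : Tendsto (fun n : ℕ => r ^ n * C) atTop (𝓝 0) := by
    simpa using (tendsto_pow_atTop_nhds_zero_of_lt_one h0 h1).mul_const C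
  exact abs_nonpos_iff.1 (ge_of_tendsto' hlim fun n => h n x)

/-- The resolvent identity between the free and the killed Green's functions. -/
theorem discountedKilledGreen_eq_green_sub (h0 : 0 ≤ r) (h1 : r < 1) (hy : y ∉ A)
    (x : ℤ × ℤ) :
    discountedKilledGreen A r y x =
      green r (x - y) - ∑ z ∈ A, discountedHit A r y z * green r (x - z) := by
  rw [← sub_eq_zero]
  refine eq_zero_of_eq_mul_latticeAvg
    (w := fun x => discountedKilledGreen A r y x -
      (green r (x - y) - ∑ z ∈ A, discountedHit A r y z * green r (x - z)))
    (C := (1 - r)⁻¹ + (green r 0 + ∑ z ∈ A, discountedHit A r y z * green r 0)) h0 h1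
    (fun x => ?_) (fun x => ?_) x
  · have habs : ∀ x, |green r x| ≤ green r 0 := fun x => by
      rw [abs_of_nonneg (green_nonneg h0 x)]; exact green_le_green_zero h0 h1 x
    refine (abs_sub _ _).trans (add_le_add ?_ ((abs_sub _ _).trans (add_le_add (habs _) ?_)))
    · rw [abs_of_nonneg (discountedKilledGreen_nonneg h0 _ _)]
      exact discountedKilledGreen_le h0 h1 y x
    · refine (Finset.abs_sum_le_sum_abs _ _).trans (Finset.sum_le_sum fun z _ => ?_)
      rw [abs_mul, abs_of_nonneg (discountedHit_nonneg h0 y z)]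
      exact mul_le_mul_of_nonneg_left (habs _) (discountedHit_nonneg h0 y z)
  · rw [latticeAvg_sub, latticeAvg_sub, latticeAvg_sum]
    simp only [latticeAvg_mul_left, latticeAvg_comp_sub]
    have hg : ∀ v, r * latticeAvg (green r) (x - v) = green r (x - v) - if x = v then 1 else 0 :=
      fun v => by
        have := green_eq h0 h1 (x - v)
        simp only [sub_eq_zero] at this
        linarith
    rw [mul_sub, mul_sub, hg, Finset.mul_sum]
    simp only [mul_left_comm r, hg, mul_sub, Finset.sum_sub_distrib]
    -- On `A` the killed Green's function vanishes, and `r` times its average is `discountedHit A r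
    -- y x`, which cancels the point source at `x` from the sum. Off `A`, the source at `y` cancels
    -- instead.
    by_cases hx : x ∈ A
    · have hxy : x ≠ y := by rintro rfl; exact hy hx
      rw [discountedKilledGreen_right_mem hx]
      simp [hx, hxy]
      rw [discountedHit]
      ring
    · rw [discountedKilledGreen_eq h0 h1 hy hx]
      have : ∑ z ∈ A, discountedHit A r y z * (if x = z then 1 else 0) = 0 := by
        simp [hx]
      rw [this]
      ring

theorem discountedKilledGreen_eq_missedGreen (h0 : 0 ≤ r) (h1 : r < 1) (hy : y ∉ A)
    (x : ℤ × ℤ) :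
    discountedKilledGreen A r y x = missedGreen A r y - potential r (x - y) +
      ∑ z ∈ A, discountedHit A r y z * potential r (x - z) := by
  rw [discountedKilledGreen_eq_green_sub h0 h1 hy, missedGreen]
  simp only [potential, mul_sub, Finset.sum_sub_distrib, ← Finset.sum_mul]
  ring

/-- At a point `x` of `A` the killed Green's function vanishes, so the resolvent identity expresses
`missedGreen` as `potential r (x - y)` minus a nonnegative sum. -/
theorem missedGreen_le (h0 : 0 ≤ r) (h1 : r < 1) (hy : y ∉ A) (hx : x ∈ A) :
    missedGreen A r y ≤ logBound (x - y) + (1 - r) * green r 0 := by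
  have h := discountedKilledGreen_eq_missedGreen h0 h1 hy x
  rw [discountedKilledGreen_right_mem hx] at h
  have h2 : 0 ≤ ∑ z ∈ A, discountedHit A r y z * potential r (x - z) :=
    Finset.sum_nonneg fun z _ =>
      mul_nonneg (discountedHit_nonneg h0 y z) (potential_nonneg h0 h1 _)
  linarith [potential_le h0 h1 (x - y)]

/-- The missed mass times `green r 0` stays bounded while `green r 0` diverges, so `A` is hit almost
surely. -/
theorem tendsto_sum_discountedHit (hA : A.Nonempty) (hy : y ∉ A) :
    Tendsto (fun r => ∑ z ∈ A, discountedHit A r y z) (𝓝[<] 1) (𝓝 1) := by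
  obtain ⟨x, hx⟩ := hA
  have h1 : Tendsto (fun r => (logBound (x - y) + (1 - r) * green r 0) / green r 0)
      (𝓝[<] 1) (𝓝 0) :=
    (tendsto_const_nhds.add tendsto_one_sub_mul_green).div_atTop tendsto_green_zero
  have h2 : Tendsto (fun r => 1 - ∑ z ∈ A, discountedHit A r y z) (𝓝[<] 1) (𝓝 0) := by
    refine squeeze_zero' ?_ ?_ h1
    · filter_upwards [eventually_discount] with r ⟨h0, h1⟩
      exact sub_nonneg.2 (sum_discountedHit_le_one h0 h1 y)
    · filter_upwards [eventually_discount, tendsto_green_zero.eventually (eventually_gt_atTop 0)]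
        with r ⟨h0, h1⟩ hg
      rw [le_div_iff₀ hg]
      exact missedGreen_le h0 h1 hy hx
  simpa using h2.const_sub 1

/-- The resolvent identity bounds the discounted sums uniformly for `r` near `1`; this bound passes
to each partial sum as `r → 1`. -/
theorem summable_killedKernel (hA : A.Nonempty) (y x : ℤ × ℤ) :
    Summable fun n => killedKernel A y n x := by
  by_cases hy : y ∈ A
  · simp [killedKernel_left_mem hy, summable_zero]
  obtain ⟨a, ha⟩ := hA
  refine summable_of_sum_range_le
    (c := logBound (a - y) + 1 + ∑ z ∈ A, (logBound (x - z) + 1))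
    (fun n => killedKernel_nonneg A y n x) fun N => ?_
  have hlim : Tendsto (fun r : ℝ => ∑ n ∈ Finset.range N, r ^ n * killedKernel A y n x)
      (𝓝[<] 1) (𝓝 (∑ n ∈ Finset.range N, killedKernel A y n x)) := by
    refine Tendsto.mono_left ?_ nhdsWithin_le_nhds
    have : Continuous fun r : ℝ =>
      ∑ n ∈ Finset.range N, r ^ n * killedKernel A y n x := by fun_prop
    simpa using this.tendsto 1
  refine le_of_tendsto hlim ?_
  filter_upwards [eventually_discount,
    tendsto_one_sub_mul_green.eventually (gt_mem_nhds one_pos)] with r ⟨h0, h1⟩ hg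
  refine ((summable_discountedKilledGreen h0 h1 y x).sum_le_tsum _ fun n _ =>
    mul_nonneg (pow_nonneg h0 n) (killedKernel_nonneg A y n x)).trans ?_
  change discountedKilledGreen A r y x ≤ _
  rw [discountedKilledGreen_eq_missedGreen h0 h1 hy]
  refine add_le_add ?_ (Finset.sum_le_sum fun z hz => ?_)
  · linarith [missedGreen_le h0 h1 hy ha, potential_nonneg h0 h1 (x - y)]
  · have hb : discountedHit A r y z ≤ 1 :=
      (Finset.single_le_sum (f := discountedHit A r y)
        (fun z _ => discountedHit_nonneg h0 y z) hz).trans (sum_discountedHit_le_one h0 h1 y)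
    refine (mul_le_of_le_one_left (potential_nonneg h0 h1 _) hb).trans ?_
    linarith [potential_le h0 h1 (x - z)]

theorem tendsto_discountedKilledGreen (hA : A.Nonempty) (y x : ℤ × ℤ) :
    Tendsto (fun r => discountedKilledGreen A r y x) (𝓝[<] 1) (𝓝 (killedGreen A y x)) := by
  have := Real.tendsto_tsum_powerSeries_nhdsWithin_lt
    (summable_killedKernel hA y x).hasSum.tendsto_sum_nat
  simpa only [discountedKilledGreen, killedGreen, mul_comm] using this

/-- The difference is a weighted sum of `green r (x - y) - green r (x - z)`, small for far `x` by
flatness, minus the missed mass times a potential, which vanishes as `r → 1` for fixed `x`. Hence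
`x` is chosen before `r`. -/
theorem eventually_abs_discountedKilledGreen_sub_le (hA : A.Nonempty) (hy : y ∉ A) {ε : ℝ}
    (hε : 0 < ε) : ∀ᶠ x in cofinite, ∀ᶠ r in 𝓝[<] 1,
      |discountedKilledGreen A r y x - missedGreen A r y| ≤ ε := by
  have hflat : ∀ᶠ x in cofinite, ∀ z ∈ A, ∀ᶠ r in 𝓝[<] 1,
      |green r (x + -y) - green r (x + -y + (y - z))| ≤ ε / 2 :=
    (Finset.eventually_all A).2 fun z _ => (add_left_injective (-y)).tendsto_cofinite.eventually
      (mem_flatDisplacements (y - z) (ε / 2) (half_pos hε))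
  filter_upwards [hflat] with x hx
  have hlim : Tendsto (fun r => (1 - ∑ z ∈ A, discountedHit A r y z) *
      (logBound (x - y) + (1 - r) * green r 0)) (𝓝[<] 1) (𝓝 0) := by
    simpa using ((tendsto_sum_discountedHit hA hy).const_sub 1).mul
      (tendsto_one_sub_mul_green.const_add (logBound (x - y)))
  filter_upwards [eventually_discount, (Finset.eventually_all A).2 hx,
    hlim.eventually (gt_mem_nhds (half_pos hε))] with r ⟨h0, h1⟩ hr hs
  have hs1 := sum_discountedHit_le_one (A := A) h0 h1 y
  have heq : discountedKilledGreen A r y x - missedGreen A r y =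
      ∑ z ∈ A, discountedHit A r y z * (green r (x - y) - green r (x - z)) -
        (1 - ∑ z ∈ A, discountedHit A r y z) * potential r (x - y) := by
    rw [discountedKilledGreen_eq_missedGreen h0 h1 hy]
    simp only [potential, mul_sub, Finset.sum_sub_distrib, ← Finset.sum_mul]
    ring
  rw [heq]
  refine (abs_sub _ _).trans ?_
  have hp : |(1 - ∑ z ∈ A, discountedHit A r y z) * potential r (x - y)| ≤ ε / 2 := by
    rw [abs_of_nonneg (mul_nonneg (sub_nonneg.2 hs1) (potential_nonneg h0 h1 _))]
    exact (mul_le_mul_of_nonneg_left (potential_le h0 h1 _) (sub_nonneg.2 hs1)).trans hs.le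
  have hq : |∑ z ∈ A, discountedHit A r y z * (green r (x - y) - green r (x - z))| ≤ ε / 2 := by
    calc _ ≤ ∑ z ∈ A, discountedHit A r y z * (ε / 2) := by
          refine (Finset.abs_sum_le_sum_abs _ _).trans (Finset.sum_le_sum fun z hz => ?_)
          rw [abs_mul, abs_of_nonneg (discountedHit_nonneg h0 y z)]
          refine mul_le_mul_of_nonneg_left ?_ (discountedHit_nonneg h0 y z)
          have := hr z hz
          rwa [← sub_eq_add_neg, sub_add_sub_cancel] at this
      _ = (∑ z ∈ A, discountedHit A r y z) * (ε / 2) := by rw [Finset.sum_mul]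
      _ ≤ ε / 2 := mul_le_of_le_one_left (half_pos hε).le hs1
  linarith

/-! ### The harmonic function of the exterior of `A`. -/

theorem killedGreen_left_mem (hy : y ∈ A) (x : ℤ × ℤ) : killedGreen A y x = 0 := by
  simp [killedGreen, killedKernel_left_mem hy]

/-- Far values of the killed Green's function are compared through `missedGreen`, which does not
involve `x`. They are therefore Cauchy, without any need for `missedGreen` itself to converge as `r
→ 1`. -/
theorem exists_tendsto_killedGreen (hA : A.Nonempty) (y : ℤ × ℤ) :
    ∃ l, Tendsto (killedGreen A y) cofinite (𝓝 l) := by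
  by_cases hy : y ∈ A
  · exact ⟨0, tendsto_const_nhds.congr fun x => (killedGreen_left_mem hy x).symm⟩
  refine cauchy_map_iff_exists_tendsto.1 (Metric.cauchy_iff.2 ⟨inferInstance, fun ε hε => ?_⟩)
  have h := eventually_abs_discountedKilledGreen_sub_le hA hy (by positivity : 0 < ε / 3)
  refine ⟨_, image_mem_map h, ?_⟩
  rintro _ ⟨x, hx, rfl⟩ _ ⟨x', hx', rfl⟩
  have hlim := ((tendsto_discountedKilledGreen hA y x).sub
    (tendsto_discountedKilledGreen hA y x')).abs
  refine (le_of_tendsto (b := ε / 3 + ε / 3) hlim ?_).trans_lt (by linarith)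
  filter_upwards [hx, hx'] with r h1 h2
  rw [abs_le] at *
  constructor <;> linarith [h1.1, h1.2, h2.1, h2.2]

/-- The limit of the killed Green's function as its second argument tends to infinity: the
harmonic function outside of `A` that vanishes on `A` and grows logarithmically. -/
noncomputable def exteriorHarmonic (A : Finset (ℤ × ℤ)) (y : ℤ × ℤ) : ℝ :=
  limUnder cofinite (killedGreen A y)

theorem tendsto_killedGreen (hA : A.Nonempty) (y : ℤ × ℤ) :
    Tendsto (killedGreen A y) cofinite (𝓝 (exteriorHarmonic A y)) :=
  tendsto_nhds_limUnder (exists_tendsto_killedGreen hA y)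

theorem exteriorHarmonic_of_mem (hA : A.Nonempty) (hy : y ∈ A) : exteriorHarmonic A y = 0 :=
  tendsto_nhds_unique (tendsto_killedGreen hA y)
    (tendsto_const_nhds.congr fun x => (killedGreen_left_mem hy x).symm)

theorem exteriorHarmonic_le (hy : y ∉ A) (hx : x ∈ A) :
    exteriorHarmonic A y ≤ logBound (x - y) := by
  have hA : A.Nonempty := ⟨x, hx⟩
  refine le_of_forall_pos_le_add fun ε hε => ?_
  refine le_of_tendsto (tendsto_killedGreen hA y) ?_
  filter_upwards [eventually_abs_discountedKilledGreen_sub_le hA hy hε] with v hv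
  have hlim : Tendsto (fun r => logBound (x - y) + (1 - r) * green r 0 + ε) (𝓝[<] 1)
      (𝓝 (logBound (x - y) + ε)) := by
    simpa using (tendsto_one_sub_mul_green.const_add (logBound (x - y))).add_const ε
  refine le_of_tendsto_of_tendsto (tendsto_discountedKilledGreen hA y v) hlim ?_
  filter_upwards [hv, eventually_discount] with r h ⟨h0, h1⟩
  linarith [(abs_le.1 h).2, missedGreen_le h0 h1 hy hx]

theorem killedGreen_eq (hA : A.Nonempty) (hy : y ∉ A) (x : ℤ × ℤ) :
    killedGreen A y x =
      (if x = y then 1 else 0) + latticeAvg (fun y' => killedGreen A y' x) y := by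
  unfold killedGreen
  rw [(summable_killedKernel hA y x).tsum_eq_zero_add,
    latticeAvg_tsum (fun y' => summable_killedKernel hA y' x)]
  simp only [killedKernel_succ_left, if_neg hy]
  congr 1
  simp [killedKernel, hy]

theorem tendsto_latticeAvg {f : ℤ × ℤ → ℤ × ℤ → ℝ} {g : ℤ × ℤ → ℝ} {l : Filter (ℤ × ℤ)}
    (h : ∀ y, Tendsto (f y) l (𝓝 (g y))) (y : ℤ × ℤ) :
    Tendsto (fun x => latticeAvg (fun y' => f y' x) y) l (𝓝 (latticeAvg g y)) :=
  (tendsto_finsetSum _ fun e _ => h (y + e)).div_const 4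

theorem exteriorHarmonic_eq_latticeAvg (hA : A.Nonempty) (hy : y ∉ A) :
    exteriorHarmonic A y = latticeAvg (exteriorHarmonic A) y := by
  refine tendsto_nhds_unique (tendsto_killedGreen hA y)
    ((tendsto_latticeAvg (tendsto_killedGreen hA) y).congr' ?_)
  filter_upwards [(Set.finite_singleton y).compl_mem_cofinite] with x hx
  rw [killedGreen_eq hA hy, if_neg (by simpa using hx), zero_add]

theorem killedGreen_symm (x y : ℤ × ℤ) : killedGreen A y x = killedGreen A x y := by
  simp only [killedGreen, fun n => killedKernel_symm (A := A) n x y]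

/-- By symmetry the far starting point `y` becomes the second argument of the killed Green's
function, so that `y → ∞` turns the sum into an average of `exteriorHarmonic A`. -/
theorem hasSum_hitProb (hA : A.Nonempty) (y z : ℤ × ℤ) :
    HasSum (fun n => hitProb A n y z) (latticeAvg (fun x => killedGreen A x y) z) := by
  simp only [fun x => killedGreen_symm (A := A) y x]
  unfold killedGreen
  rw [latticeAvg_tsum (summable_killedKernel hA y)]
  exact (summable_latticeAvg (summable_killedKernel hA y) z).hasSum

theorem one_le_sum_tsum_hitProb (hA : A.Nonempty) (hy : y ∉ A) :
    1 ≤ ∑ z ∈ A, ∑' n, hitProb A n y z := by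
  refine le_of_tendsto (tendsto_sum_discountedHit hA hy) ?_
  filter_upwards [eventually_discount] with r ⟨h0, h1⟩
  refine Finset.sum_le_sum fun z _ => ?_
  exact hasSum_le (fun n => mul_le_of_le_one_left (hitProb_nonneg A n y z)
    (pow_le_one₀ h0 h1.le)) (hasSum_discountedHit h0 h1 y z) (hasSum_hitProb hA y z).summable.hasSum

end Killed

/-! ### From kernels to the law of the walk. -/

/-- The sequence of steps that starts with `e` and goes on with `ω`. -/
def prependStep (e : ℤ × ℤ) (ω : ℕ → ℤ × ℤ) : ℕ → ℤ × ℤ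
  | 0 => e
  | n + 1 => ω n

theorem measurable_prependStep :
    Measurable fun p : (ℤ × ℤ) × (ℕ → ℤ × ℤ) => prependStep p.1 p.2 := by
  refine measurable_pi_lambda _ fun n => ?_
  cases n with
  | zero => exact measurable_fst
  | succ n => exact (measurable_pi_apply n).comp measurable_snd

/-- The shift structure of an i.i.d. sequence, checked on finite cylinders. It is the form of the
Markov property used throughout. -/
theorem map_prependStep :
    (stepLaw.prod stepsLaw).map (fun p => prependStep p.1 p.2) = stepsLaw := by
  refine Measure.eq_infinitePi _ fun s t ht => ?_
  classical
  -- The finite index set is padded with trivial constraints to an initial segment containing `0`,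
  -- so that the first coordinate can be split off.
  obtain ⟨N, hN⟩ : ∃ N, s ⊆ Finset.range (N + 1) :=
    ⟨s.sup id, fun i hi => Finset.mem_range.2 (Nat.lt_succ_of_le (Finset.le_sup (f := id) hi))⟩
  set t' : ℕ → Set (ℤ × ℤ) := fun i => if i ∈ s then t i else Set.univ with ht'
  have hm : ∀ i, MeasurableSet (t' i) := fun i => by
    simp only [ht']; split_ifs
    · exact ht i
    · exact MeasurableSet.univ
  have hpi : Set.pi (s : Set ℕ) t = Set.pi (Finset.range (N + 1) : Set ℕ) t' := by
    ext ω
    simp only [Set.mem_pi, Finset.mem_coe, ht']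
    constructor
    · intro h i _
      split_ifs with hi
      · exact h i hi
      · trivial
    · intro h i hi
      simpa [hi] using h i (hN hi)
  have hprod : ∏ i ∈ s, stepLaw (t i) = ∏ i ∈ Finset.range (N + 1), stepLaw (t' i) := by
    rw [← Finset.prod_subset hN (f := fun i => stepLaw (t' i))]
    · exact Finset.prod_congr rfl fun i hi => by simp [ht', hi]
    · intro i _ hi
      simp [ht', hi]
  rw [hprod, hpi, Measure.map_apply measurable_prependStep
    (MeasurableSet.pi (Set.to_countable _) fun i _ => hm i)]
  have hpre : (fun p : (ℤ × ℤ) × (ℕ → ℤ × ℤ) => prependStep p.1 p.2) ⁻¹'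
      Set.pi (Finset.range (N + 1) : Set ℕ) t' =
      t' 0 ×ˢ Set.pi (Finset.range N : Set ℕ) fun i => t' (i + 1) := by
    ext ⟨e, ω⟩
    simp only [Set.mem_preimage, Set.mem_pi, Finset.mem_coe, Finset.mem_range, Set.mem_prod]
    constructor
    · exact fun h => ⟨h 0 (by omega), fun i hi => h (i + 1) (by omega)⟩
    · rintro ⟨h0, h⟩ i hi
      cases i with
      | zero => exact h0
      | succ i => exact h i (by omega)
  rw [hpre, Measure.prod_prod, stepsLaw, Measure.infinitePi_pi _ fun i _ => hm (i + 1),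
    Finset.prod_range_succ', mul_comm]

theorem stepLaw_singleton (e : ℤ × ℤ) : stepLaw {e} = if e ∈ unitSteps then 4⁻¹ else 0 := by
  rw [stepLaw, PMF.toMeasure_apply_singleton _ _ (measurableSet_singleton e),
    PMF.uniformOfFinset_apply, card_unitSteps]
  norm_num

/-- The decomposition of an event according to the first step of the walk. -/
theorem stepsLaw_real_eq {E : Set (ℕ → ℤ × ℤ)} (hE : MeasurableSet E) :
    stepsLaw.real E = (∑ e ∈ unitSteps, stepsLaw.real {ω | prependStep e ω ∈ E}) / 4 := by
  have h : stepsLaw E = ∑ e ∈ unitSteps, stepsLaw {ω | prependStep e ω ∈ E} * 4⁻¹ := by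
    conv_lhs => rw [← map_prependStep]
    rw [Measure.map_apply measurable_prependStep hE,
      Measure.prod_apply (measurable_prependStep hE), lintegral_countable',
      tsum_eq_sum (s := unitSteps) fun e he => by rw [stepLaw_singleton, if_neg he, mul_zero]]
    exact Finset.sum_congr rfl fun e he => by rw [stepLaw_singleton, if_pos he]; rfl
  rw [measureReal_def, h, ENNReal.toReal_sum fun e _ =>
    ENNReal.mul_ne_top (measure_ne_top _ _) (by simp), Finset.sum_div]
  refine Finset.sum_congr rfl fun e _ => ?_
  rw [ENNReal.toReal_mul, measureReal_def]
  simp [div_eq_mul_inv]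

theorem walk_prependStep (x e : ℤ × ℤ) (n : ℕ) (ω : ℕ → ℤ × ℤ) :
    walk x (n + 1) (prependStep e ω) = walk (x + e) n ω := by
  simp only [walk, Finset.sum_range_succ', prependStep]
  abel

theorem walk_zero (x : ℤ × ℤ) (ω : ℕ → ℤ × ℤ) : walk x 0 ω = x := by simp [walk]

theorem measurable_walk (x : ℤ × ℤ) (n : ℕ) : Measurable (walk x n) := by
  unfold walk
  exact measurable_const.add (Finset.measurable_fun_sum _ fun i _ => measurable_pi_apply i)

theorem measurableSet_walk_mem (x : ℤ × ℤ) (n : ℕ) (S : Set (ℤ × ℤ)) :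
    MeasurableSet {ω | walk x n ω ∈ S} :=
  measurable_walk x n S.to_countable.measurableSet

theorem hitTime_eq_coe_iff {x : ℤ × ℤ} {B : Set (ℤ × ℤ)} {ω : ℕ → ℤ × ℤ} {j : ℕ} :
    hitTime x B ω = (j : WithTop ℕ) ↔
      1 ≤ j ∧ walk x j ω ∈ B ∧ ∀ i, 1 ≤ i → i < j → walk x i ω ∉ B := by
  unfold hitTime
  constructor
  · intro h
    obtain ⟨i, ⟨hi1, hij⟩, hi⟩ := hittingAfter_le_iff.1 h.le
    have hlt : ∀ i, 1 ≤ i → i < j → walk x i ω ∉ B := fun i hi1 hij =>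
      notMem_of_lt_hittingAfter (by rw [h]; exact WithTop.coe_lt_coe.2 hij) hi1
    rcases hij.lt_or_eq with hij | rfl
    · exact absurd hi (hlt i hi1 hij)
    · exact ⟨hi1, hi, hlt⟩
  · rintro ⟨h1, h2, h3⟩
    refine le_antisymm (hittingAfter_le_of_mem h1 h2) (not_lt.1 fun h => ?_)
    obtain ⟨i, ⟨hi1, hij⟩, hi⟩ := hittingAfter_lt_iff.1 h
    exact h3 i hi1 hij hi

/-- The event that the walk from `x` is at `z` at time `n + 1` and avoids `A` at the times
`1, …, n`. -/
def hitEvent (A : Finset (ℤ × ℤ)) (n : ℕ) (x z : ℤ × ℤ) : Set (ℕ → ℤ × ℤ) :=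
  {ω | walk x (n + 1) ω = z ∧ ∀ j < n, walk x (j + 1) ω ∉ A}

theorem measurableSet_hitEvent (A : Finset (ℤ × ℤ)) (n : ℕ) (x z : ℤ × ℤ) :
    MeasurableSet (hitEvent A n x z) := by
  have : hitEvent A n x z = {ω | walk x (n + 1) ω ∈ ({z} : Set (ℤ × ℤ))} ∩
      ⋂ j, ⋂ (_ : j < n), {ω | walk x (j + 1) ω ∈ (A : Set (ℤ × ℤ))ᶜ} := by
    ext ω; simp [hitEvent]
  rw [this]
  refine (measurableSet_walk_mem x (n + 1) {z}).inter ?_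
  exact MeasurableSet.iInter fun j => MeasurableSet.iInter fun _ =>
    measurableSet_walk_mem x (j + 1) ((A : Set (ℤ × ℤ))ᶜ)

theorem stepsLaw_real_hitEvent {A : Finset (ℤ × ℤ)} (n : ℕ) {x : ℤ × ℤ} (hx : x ∉ A)
    (z : ℤ × ℤ) : stepsLaw.real (hitEvent A n x z) = hitProb A n x z := by
  induction n generalizing x with
  | zero =>
    rw [stepsLaw_real_eq (measurableSet_hitEvent _ _ _ _), hitProb_zero hx]
    unfold latticeAvg
    congr 1
    refine Finset.sum_congr rfl fun e _ => ?_
    by_cases h : x + e = z <;> simp [hitEvent, walk_prependStep, walk_zero, h]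
  | succ n ih =>
    rw [stepsLaw_real_eq (measurableSet_hitEvent _ _ _ _), hitProb_succ hx]
    unfold latticeAvg
    congr 1
    refine Finset.sum_congr rfl fun e _ => ?_
    beta_reduce
    by_cases h : x + e ∈ A
    · have : {ω | prependStep e ω ∈ hitEvent A (n + 1) x z} = ∅ := by
        refine Set.eq_empty_of_forall_notMem fun ω hω => hω.2 0 n.succ_pos ?_
        rwa [walk_prependStep, walk_zero]
      rw [this, measureReal_empty, hitProb_left_mem h]
    · rw [← ih h]
      congr 1
      ext ω
      simp only [hitEvent, Set.mem_ofPred_eq, walk_prependStep]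
      refine and_congr_right fun _ => ⟨fun h' j hj => h' (j + 1) (by omega), fun h' j hj => ?_⟩
      cases j with
      | zero => rwa [walk_zero]
      | succ j => exact h' j (by omega)

/-- Since `z ∈ A`, the hitting event is the disjoint union of the `hitEvent`s, whose index `n`
stands for time `n + 1`. -/
theorem hittingDist_eq_tsum {A : Finset (ℤ × ℤ)} {x z : ℤ × ℤ} (hx : x ∉ A) (hz : z ∈ A) :
    hittingDist A x z = ∑' n, hitProb A n x z := by
  have hU : {ω | ∃ j : ℕ, hitTime x (A : Set (ℤ × ℤ)) ω = (j : WithTop ℕ) ∧ walk x j ω = z} =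
      ⋃ n, hitEvent A n x z := by
    ext ω
    simp only [Set.mem_ofPred_eq, Set.mem_iUnion, hitTime_eq_coe_iff, hitEvent]
    constructor
    · rintro ⟨j, ⟨h1, _, h3⟩, h4⟩
      refine ⟨j - 1, by rwa [Nat.sub_add_cancel h1], fun i hi => ?_⟩
      exact_mod_cast h3 (i + 1) (by omega) (by omega)
    · rintro ⟨n, h1, h2⟩
      refine ⟨n + 1, ⟨by omega, by rw [h1]; exact_mod_cast hz, fun i hi1 hi2 => ?_⟩, h1⟩
      have := h2 (i - 1) (by omega)
      rw [Nat.sub_add_cancel hi1] at this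
      exact_mod_cast this
  have hlt : ∀ {m n : ℕ} {ω}, m < n → ω ∈ hitEvent A m x z → ω ∉ hitEvent A n x z :=
    fun hmn hm hn => hn.2 _ hmn (by rw [hm.1]; exact hz)
  have hdisj : Pairwise (Function.onFun Disjoint fun n => hitEvent A n x z) := fun m n hmn =>
    Set.disjoint_left.2 fun ω hm hn => by
      rcases hmn.lt_or_gt with h | h
      · exact hlt h hm hn
      · exact hlt h hn hm
  rw [hittingDist, hU, measureReal_def,
    measure_iUnion hdisj fun n => measurableSet_hitEvent A n x z,
    ENNReal.tsum_toReal_eq fun n => measure_ne_top _ _]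
  exact tsum_congr fun n => stepsLaw_real_hitEvent n hx z

theorem hittingDist_of_notMem {A : Finset (ℤ × ℤ)} {z : ℤ × ℤ} (hz : z ∉ A) (x : ℤ × ℤ) :
    hittingDist A x z = 0 := by
  have : {ω | ∃ j : ℕ, hitTime x (A : Set (ℤ × ℤ)) ω = (j : WithTop ℕ) ∧ walk x j ω = z} = ∅ := by
    refine Set.eq_empty_of_forall_notMem ?_
    rintro ω ⟨j, hj, rfl⟩
    exact hz (by exact_mod_cast (hitTime_eq_coe_iff.1 hj).2.1)
  rw [hittingDist, this, measureReal_empty]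

/-- The event that the walk from `x` visits `D`, at a positive time, before it enters `A`. -/
def visitBeforeEvent (A : Finset (ℤ × ℤ)) (D : Set (ℤ × ℤ)) (x : ℤ × ℤ) : Set (ℕ → ℤ × ℤ) :=
  {ω | ∃ n, walk x (n + 1) ω ∈ D ∧ ∀ j ≤ n, walk x (j + 1) ω ∉ A}

theorem measurableSet_visitBeforeEvent (A : Finset (ℤ × ℤ)) (D : Set (ℤ × ℤ)) (x : ℤ × ℤ) :
    MeasurableSet (visitBeforeEvent A D x) := by
  have : visitBeforeEvent A D x = ⋃ n, {ω | walk x (n + 1) ω ∈ D} ∩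
      ⋂ j, ⋂ (_ : j ≤ n), {ω | walk x (j + 1) ω ∈ (A : Set (ℤ × ℤ))ᶜ} := by
    ext ω; simp [visitBeforeEvent]
  rw [this]
  refine MeasurableSet.iUnion fun n => (measurableSet_walk_mem x (n + 1) D).inter ?_
  exact MeasurableSet.iInter fun j => MeasurableSet.iInter fun _ =>
    measurableSet_walk_mem x (j + 1) ((A : Set (ℤ × ℤ))ᶜ)

theorem hitTime_lt_hitTime_iff {A : Finset (ℤ × ℤ)} {D : Set (ℤ × ℤ)} {x : ℤ × ℤ}
    {ω : ℕ → ℤ × ℤ} :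
    hitTime x D ω < hitTime x (A : Set (ℤ × ℤ)) ω ↔ ω ∈ visitBeforeEvent A D x := by
  constructor
  · intro h
    obtain ⟨j, hj⟩ := WithTop.ne_top_iff_exists.1 h.ne_top
    obtain ⟨h1, h2, _⟩ := hitTime_eq_coe_iff.1 hj.symm
    refine ⟨j - 1, by rwa [Nat.sub_add_cancel h1], fun i hi => ?_⟩
    have : walk x (i + 1) ω ∉ (A : Set (ℤ × ℤ)) := by
      refine notMem_of_lt_hittingAfter (n := 1) (lt_of_le_of_lt ?_ h) (by omega)
      rw [← hj]
      exact_mod_cast (by omega : i + 1 ≤ j)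
    exact_mod_cast this
  · rintro ⟨n, h1, h2⟩
    refine lt_of_le_of_lt (hittingAfter_le_of_mem (by omega : 1 ≤ n + 1) h1) (not_le.1 fun h => ?_)
    obtain ⟨i, ⟨hi1, hin⟩, hi⟩ := hittingAfter_le_iff.1 h
    refine h2 (i - 1) (by omega) ?_
    rw [Nat.sub_add_cancel hi1]
    exact_mod_cast hi

-- First-step analysis. As hitting times start at `1`, the identity also holds for `x ∈ A`, where
-- the averaged function is `0`; that case is the one needed for escape from `A`.
open scoped Classical in
theorem stepsLaw_real_visitBeforeEvent (A : Finset (ℤ × ℤ)) (D : Set (ℤ × ℤ)) (x : ℤ × ℤ) :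
    stepsLaw.real (visitBeforeEvent A D x) = latticeAvg
      (fun y => if y ∈ A then 0 else if y ∈ D then 1 else stepsLaw.real (visitBeforeEvent A D y))
      x := by
  rw [stepsLaw_real_eq (measurableSet_visitBeforeEvent A D x)]
  unfold latticeAvg
  congr 1
  refine Finset.sum_congr rfl fun e _ => ?_
  beta_reduce
  split_ifs with hA hD
  · have : {ω | prependStep e ω ∈ visitBeforeEvent A D x} = ∅ := by
      refine Set.eq_empty_of_forall_notMem ?_
      rintro ω ⟨n, _, h⟩
      have := h 0 n.zero_le
      rw [walk_prependStep, walk_zero] at this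
      exact this hA
    rw [this, measureReal_empty]
  · have : {ω | prependStep e ω ∈ visitBeforeEvent A D x} = Set.univ := by
      refine Set.eq_univ_of_forall fun ω => ⟨0, ?_, fun j hj => ?_⟩
      · rwa [walk_prependStep, walk_zero]
      · rwa [Nat.le_zero.1 hj, walk_prependStep, walk_zero]
    rw [this, probReal_univ]
  · congr 1
    ext ω
    simp only [visitBeforeEvent, Set.mem_ofPred_eq, walk_prependStep]
    constructor
    · rintro ⟨n, h1, h2⟩
      cases n with
      | zero => rw [walk_zero] at h1; exact absurd h1 hD
      | succ n => exact ⟨n, h1, fun j hj => h2 (j + 1) (by omega)⟩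
    · rintro ⟨n, h1, h2⟩
      refine ⟨n + 1, h1, fun j hj => ?_⟩
      cases j with
      | zero => rwa [walk_zero]
      | succ j => exact h2 j (by omega)

theorem escapeProb_eq (A : Finset (ℤ × ℤ)) (d : ℝ) (x : ℤ × ℤ) :
    escapeProb A d x =
      stepsLaw.real (visitBeforeEvent A (exteriorBoundary (fattening A d)) x) := by
  unfold escapeProb
  congr 1
  ext ω
  exact hitTime_lt_hitTime_iff

/-! ### The minimum principle and the comparison on `A_d \ A`. -/

/-- The minimum principle on a finite set of sites. -/
theorem nonneg_of_eq_latticeAvg {U : Set (ℤ × ℤ)} (hU : U.Finite) {φ : ℤ × ℤ → ℝ}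
    (havg : ∀ y ∈ U, φ y = latticeAvg φ y)
    (hbd : ∀ y ∈ U, ∀ e ∈ unitSteps, y + e ∉ U → 0 ≤ φ (y + e)) {y : ℤ × ℤ} (hy : y ∈ U) :
    0 ≤ φ y := by
  by_contra! hneg
  obtain ⟨v, hv, hmin⟩ := hU.exists_minimalFor φ U ⟨y, hy⟩
  have hmin' : ∀ u ∈ U, φ v ≤ φ u := fun u hu => by
    rcases le_total (φ v) (φ u) with h | h
    · exact h
    · exact hmin hu h
  have hvneg : φ v < 0 := (hmin' y hy).trans_lt hneg
  -- Among the minimizers, `w` has the largest first coordinate. Its right neighbour is then a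
  -- minimizer too, so it lies outside `U`, where the boundary condition forbids a negative value.
  obtain ⟨w, ⟨hw, hwv⟩, hmax⟩ := (hU.subset (Set.sep_subset U fun u => φ u = φ v)).exists_maximalFor
    Prod.fst _ ⟨v, hv, rfl⟩
  have hnbr : ∀ e ∈ unitSteps, φ v ≤ φ (w + e) := fun e he => by
    by_cases h : w + e ∈ U
    · exact hmin' _ h
    · exact hvneg.le.trans (hbd w hw e he h)
  have hright : φ (w + (1, 0)) = φ v := by
    have h := havg w hw
    rw [latticeAvg, sum_unitSteps, hwv] at h
    have h1 := hnbr (1, 0) (by simp [unitSteps])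
    have h2 := hnbr (-1, 0) (by simp [unitSteps])
    have h3 := hnbr (0, 1) (by simp [unitSteps])
    have h4 := hnbr (0, -1) (by simp [unitSteps])
    linarith
  by_cases h : w + (1, 0) ∈ U
  · have := hmax (show w + (1, 0) ∈ {u | u ∈ U ∧ φ u = φ v} from ⟨h, hright⟩) (by simp)
    simp at this
  · have := hbd w hw (1, 0) (by simp [unitSteps]) h
    linarith

theorem dist_toPlane_sq (x y : ℤ × ℤ) :
    dist (toPlane x) (toPlane y) ^ 2 = ((x.1 : ℝ) - y.1) ^ 2 + ((x.2 : ℝ) - y.2) ^ 2 := by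
  rw [EuclideanSpace.dist_eq, Real.sq_sqrt (by positivity)]
  simp [toPlane, Real.dist_eq, sq_abs]

theorem dist_toPlane_add_unitStep {x e : ℤ × ℤ} (he : e ∈ unitSteps) :
    dist (toPlane (x + e)) (toPlane x) = 1 := by
  have h := dist_toPlane_sq (x + e) x
  rw [← abs_of_nonneg (dist_nonneg (x := toPlane (x + e)) (y := toPlane x)), ← sq_eq_sq₀
    (abs_nonneg _) zero_le_one, sq_abs, h]
  simp only [unitSteps, Finset.mem_insert, Finset.mem_singleton] at he
  rcases he with rfl | rfl | rfl | rfl <;> simp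

theorem one_le_dist_toPlane {x y : ℤ × ℤ} (h : x ≠ y) : 1 ≤ dist (toPlane x) (toPlane y) := by
  rw [← sq_le_sq₀ zero_le_one dist_nonneg, dist_toPlane_sq]
  have h1 : (1 : ℤ) ≤ (x.1 - y.1) ^ 2 + (x.2 - y.2) ^ 2 := by
    by_contra! hlt
    refine h (Prod.ext ?_ ?_) <;> nlinarith [sq_nonneg (x.1 - y.1), sq_nonneg (x.2 - y.2)]
  exact_mod_cast (by linarith : (1 : ℤ) ^ 2 ≤ (x.1 - y.1) ^ 2 + (x.2 - y.2) ^ 2)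

theorem finite_fattening (A : Finset (ℤ × ℤ)) (d : ℝ) : (fattening A d).Finite := by
  have h : fattening A d ⊆ ⋃ a ∈ A, Set.Icc (a.1 - ⌈d⌉, a.2 - ⌈d⌉) (a.1 + ⌈d⌉, a.2 + ⌈d⌉) := by
    rintro z ⟨a, ha, hz⟩
    have hsq := dist_toPlane_sq z a
    have hd : d ≤ (⌈d⌉ : ℝ) := Int.le_ceil d
    have h1 : |(z.1 : ℝ) - a.1| ≤ dist (toPlane z) (toPlane a) :=
      abs_le_of_sq_le_sq (by nlinarith [sq_nonneg ((z.2 : ℝ) - a.2)]) dist_nonneg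
    have h2 : |(z.2 : ℝ) - a.2| ≤ dist (toPlane z) (toPlane a) :=
      abs_le_of_sq_le_sq (by nlinarith [sq_nonneg ((z.1 : ℝ) - a.1)]) dist_nonneg
    have h3 : |z.1 - a.1| ≤ ⌈d⌉ := by exact_mod_cast h1.trans (hz.trans hd)
    have h4 : |z.2 - a.2| ≤ ⌈d⌉ := by exact_mod_cast h2.trans (hz.trans hd)
    rw [abs_le] at h3 h4
    refine Set.mem_biUnion ha ⟨⟨?_, ?_⟩, ⟨?_, ?_⟩⟩ <;> simp only <;> linarith
  exact (A.finite_toSet.biUnion fun a _ => Set.finite_Icc _ _).subset h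

theorem subset_fattening {A : Finset (ℤ × ℤ)} {d : ℝ} (hd : 0 ≤ d) :
    (A : Set (ℤ × ℤ)) ⊆ fattening A d := fun a ha => ⟨a, ha, by simpa using hd⟩

theorem mem_exteriorBoundary_of_unitStep {B : Set (ℤ × ℤ)} {x e : ℤ × ℤ} (hx : x ∈ B)
    (he : e ∈ unitSteps) (h : x + e ∉ B) : x + e ∈ exteriorBoundary B :=
  ⟨h, x, hx, dist_toPlane_add_unitStep he⟩

/-- A site of `∂A_d` is within `d + 1` of some `a ∈ A`. For `d ≥ 2`, `2(d+1)² + 3 ≤ d⁵` and `2 ≤ 3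
log 2 ≤ 3 log d`, whence `8 = 5 + 3`. -/
theorem exteriorHarmonic_le_of_mem_exteriorBoundary {A : Finset (ℤ × ℤ)} {d : ℝ} (hd : 2 ≤ d)
    {z : ℤ × ℤ} (hz : z ∈ exteriorBoundary (fattening A d)) :
    exteriorHarmonic A z ≤ 8 * Real.log d := by
  obtain ⟨hz1, w, ⟨a, ha, hwa⟩, hzw⟩ := hz
  have hzA : z ∉ A := fun h => hz1 (subset_fattening (by linarith) h)
  refine (exteriorHarmonic_le hzA ha).trans ?_
  have hza : dist (toPlane z) (toPlane a) ≤ d + 1 :=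
    (dist_triangle _ (toPlane w) _).trans (by linarith)
  have hsq : ((a - z).1 : ℝ) ^ 2 + ((a - z).2 : ℝ) ^ 2 ≤ (d + 1) ^ 2 := by
    have h := dist_toPlane_sq a z
    rw [dist_comm] at hza
    simp only [Prod.fst_sub, Prod.snd_sub, Int.cast_sub]
    rw [← h]
    exact pow_le_pow_left₀ dist_nonneg hza 2
  have hpow : 2 * (d + 1) ^ 2 + 3 ≤ d ^ 5 := by
    have h3 : (2 : ℝ) ^ 3 ≤ d ^ 3 := pow_le_pow_left₀ (by norm_num) hd 3
    nlinarith [mul_le_mul_of_nonneg_right h3 (sq_nonneg d)]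
  have hlog : Real.log (2 * (((a - z).1 : ℝ) ^ 2 + ((a - z).2 : ℝ) ^ 2) + 3) ≤ 5 * Real.log d := by
    refine (Real.log_le_log (by positivity) (by linarith : _ ≤ d ^ 5)).trans_eq ?_
    rw [Real.log_pow]; norm_num
  have hlog2 : Real.log 2 ≤ Real.log d := Real.log_le_log two_pos hd
  unfold logBound
  linarith [Real.log_two_gt_d9]

-- The function `φ`, which is `8 log d` times the escape probability minus `exteriorHarmonic A`, is
-- harmonic in `A_d \ A`, zero on `A` and nonnegative on `∂A_d`. It is therefore nonnegative at all
-- neighbours of `x`, and averaging there gives the bound.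
open scoped Classical in
theorem latticeAvg_exteriorHarmonic_le {A : Finset (ℤ × ℤ)} {d : ℝ} (hd : 2 ≤ d) {x : ℤ × ℤ}
    (hx : x ∈ A) :
    latticeAvg (exteriorHarmonic A) x ≤ 8 * Real.log d * escapeProb A d x := by
  have hA : A.Nonempty := ⟨x, hx⟩
  set D := exteriorBoundary (fattening A d) with hD
  set M := 8 * Real.log d
  set ψ : ℤ × ℤ → ℝ := fun y =>
    if y ∈ A then 0 else if y ∈ D then 1 else stepsLaw.real (visitBeforeEvent A D y) with hψ
  have hAF : ∀ y ∈ A, y ∈ fattening A d := fun y hy => subset_fattening (by linarith) hy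
  set φ : ℤ × ℤ → ℝ := fun y => M * ψ y - exteriorHarmonic A y with hφ
  have hφA : ∀ y ∈ A, 0 ≤ φ y := fun y hy => by
    simp [hφ, hψ, hy, exteriorHarmonic_of_mem hA hy]
  have hφD : ∀ y ∈ D, 0 ≤ φ y := fun y hy => by
    have hyA : y ∉ A := fun h => hy.1 (hAF y h)
    simpa [hφ, hψ, hy, hyA] using exteriorHarmonic_le_of_mem_exteriorBoundary hd hy
  have hψavg : ∀ y, stepsLaw.real (visitBeforeEvent A D y) = latticeAvg ψ y :=
    stepsLaw_real_visitBeforeEvent A D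
  have havg : ∀ y ∈ fattening A d \ A, φ y = latticeAvg φ y := fun y hy => by
    have hyD : y ∉ D := fun h => h.1 hy.1
    have hyA : y ∉ A := hy.2
    simp only [hφ]
    rw [latticeAvg_sub, latticeAvg_mul_left, ← hψavg, ← exteriorHarmonic_eq_latticeAvg hA hyA]
    simp [hψ, hyD, hyA]
  have hbd : ∀ y ∈ fattening A d, ∀ e ∈ unitSteps, y + e ∉ fattening A d \ A → 0 ≤ φ (y + e) :=
    fun y hy e he h => by
      by_cases hF : y + e ∈ fattening A d
      · exact hφA _ (by_contra fun hn => h ⟨hF, hn⟩)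
      · exact hφD _ (mem_exteriorBoundary_of_unitStep hy he hF)
  have hφnbr : ∀ e ∈ unitSteps, 0 ≤ φ (x + e) := fun e he => by
    by_cases h : x + e ∈ fattening A d \ A
    · exact nonneg_of_eq_latticeAvg ((finite_fattening A d).subset Set.sdiff_subset) havg
        (fun y hy => hbd y hy.1) h
    · exact hbd x (hAF x hx) e he h
  have := latticeAvg_nonneg hφnbr
  simp only [hφ] at this
  rw [latticeAvg_sub, latticeAvg_mul_left, ← hψavg] at this
  rw [escapeProb_eq]
  linarith

/-! ### Harmonic measure and the conclusion. -/

theorem eventually_notMem (A : Finset (ℤ × ℤ)) : ∀ᶠ x in cofinite, x ∉ A :=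
  A.finite_toSet.compl_mem_cofinite

theorem tendsto_hittingDist {A : Finset (ℤ × ℤ)} {z : ℤ × ℤ} (hz : z ∈ A) :
    Tendsto (fun x => hittingDist A x z) cofinite (𝓝 (latticeAvg (exteriorHarmonic A) z)) := by
  have hA : A.Nonempty := ⟨z, hz⟩
  refine (tendsto_latticeAvg (tendsto_killedGreen hA) z).congr' ?_
  filter_upwards [eventually_notMem A] with x hx
  rw [hittingDist_eq_tsum hx hz, (hasSum_hitProb hA x z).tsum_eq]

theorem tendsto_harmonicMeasure (A : Finset (ℤ × ℤ)) (z : ℤ × ℤ) :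
    Tendsto (fun x => hittingDist A x z) cofinite (𝓝 (harmonicMeasure A z)) := by
  refine tendsto_nhds_limUnder ?_
  by_cases hz : z ∈ A
  · exact ⟨_, tendsto_hittingDist hz⟩
  · exact ⟨0, tendsto_const_nhds.congr fun x => (hittingDist_of_notMem hz x).symm⟩

theorem harmonicMeasure_eq {A : Finset (ℤ × ℤ)} {z : ℤ × ℤ} (hz : z ∈ A) :
    harmonicMeasure A z = latticeAvg (exteriorHarmonic A) z :=
  tendsto_nhds_unique (tendsto_harmonicMeasure A z) (tendsto_hittingDist hz)

/-- By recurrence the hitting distributions from sites off `A` have total mass at least `1`, and a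
finite sum passes to the limit. -/
theorem one_le_sum_harmonicMeasure {A : Finset (ℤ × ℤ)} (hA : A.Nonempty) :
    1 ≤ ∑ z ∈ A, harmonicMeasure A z := by
  refine ge_of_tendsto (tendsto_finsetSum A fun z _ => tendsto_harmonicMeasure A z) ?_
  filter_upwards [eventually_notMem A] with x hx
  refine (one_le_sum_tsum_hitProb hA hx).trans_eq ?_
  exact Finset.sum_congr rfl fun z hz => (hittingDist_eq_tsum hx hz).symm

theorem exists_inv_card_le_harmonicMeasure {A : Finset (ℤ × ℤ)} (hA : A.Nonempty) :
    ∃ x ∈ A, 1 / (A.card : ℝ) ≤ harmonicMeasure A x := by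
  refine Finset.exists_le_of_sum_le hA ?_
  have hn : (A.card : ℝ) ≠ 0 := by exact_mod_cast hA.card_pos.ne'
  simpa [hn] using one_le_sum_harmonicMeasure hA

theorem one_le_latticeDiam {A : Finset (ℤ × ℤ)} (hA : 2 ≤ A.card) : 1 ≤ latticeDiam A := by
  obtain ⟨x, hx, y, hy, hxy⟩ := Finset.one_lt_card.1 hA
  exact (one_le_dist_toPlane hxy).trans (Metric.dist_le_diam_of_mem
    (A.finite_toSet.image toPlane).isBounded ⟨x, hx, rfl⟩ ⟨y, hy, rfl⟩)

/-- The first conjunct records that the limits defining the harmonic measure of `A` exist. -/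
theorem theorem2 :
    ∃ c : ℝ, 0 < c ∧ ∀ A : Finset (ℤ × ℤ), 2 ≤ A.card →
      (∀ y : ℤ × ℤ, Tendsto (fun x => hittingDist A x y) cofinite (𝓝 (harmonicMeasure A y))) ∧
      ∀ d : ℝ, 2 * latticeDiam A ≤ d →
        (∀ x ∈ A, c * harmonicMeasure A x / ((A.card : ℝ) * Real.log d) ≤ escapeProb A d x) ∧
        (∃ x ∈ A, c / ((A.card : ℝ) ^ 2 * Real.log d) ≤ escapeProb A d x) := by
  refine ⟨1 / 8, by norm_num, fun A hA => ⟨tendsto_harmonicMeasure A, fun d hd => ?_⟩⟩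
  have hd2 : 2 ≤ d := by linarith [one_le_latticeDiam hA]
  have hlog : 0 < Real.log d := Real.log_pos (by linarith)
  have hn : (1 : ℝ) ≤ A.card := by exact_mod_cast (by omega : 1 ≤ A.card)
  have hne : A.Nonempty := Finset.card_pos.1 (by omega)
  have hmain : ∀ x ∈ A,
      1 / 8 * harmonicMeasure A x / ((A.card : ℝ) * Real.log d) ≤ escapeProb A d x := by
    intro x hx
    have h := latticeAvg_exteriorHarmonic_le hd2 hx
    rw [← harmonicMeasure_eq hx] at h
    have hE : 0 ≤ escapeProb A d x := measureReal_nonneg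
    rw [div_le_iff₀ (by positivity)]
    -- The comparison gives the bound without the factor `A.card`, which is then introduced using `1
    -- ≤ A.card`.
    calc 1 / 8 * harmonicMeasure A x ≤ escapeProb A d x * (1 * Real.log d) := by linarith
      _ ≤ escapeProb A d x * (A.card * Real.log d) := by gcongr
  refine ⟨hmain, ?_⟩
  obtain ⟨x, hx, hH⟩ := exists_inv_card_le_harmonicMeasure hne
  refine ⟨x, hx, le_trans ?_ (hmain x hx)⟩
  have hn0 : (0 : ℝ) < A.card := by linarith
  calc 1 / 8 / ((A.card : ℝ) ^ 2 * Real.log d)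
      = 1 / 8 * (1 / (A.card : ℝ)) / ((A.card : ℝ) * Real.log d) := by field_simp
    _ ≤ 1 / 8 * harmonicMeasure A x / ((A.card : ℝ) * Real.log d) := by gcongr
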